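/- **Conventions.** A function $f:\mathbb R^2\to\mathbb R$ is positively $1$-homogeneous if $f(\alpha y)=\alpha f(y)$ for $\alpha>0$. A *weak Minkowski norm* on $\mathbb R^2$ is a positively $1$-homogeneous function $f$ with $f(y)>0$ for $y\ne0$, smooth on $\mathbb R^2\setminus\{0\}$, and satisfying $f(y_1+y_2)\le f(y_1)+f(y_2)$, with equality only if $\alpha_1y_1=\alpha_2y_2$ for some $\alpha_1,\alpha_2\ge0$ with $\alpha_1+\alpha_2>0$. It is a *Minkowski norm* if moreover the matrix $\big([f^2]_{y^iy^j}(y)\big)$ is positive definite for every $y\neq 0$. Let $\Omega\subset\mathbb R^2$ and $F:\Omega\times\mathbb R^2\to\mathbb R$ be given by one of the following two constructions. * **($\mathbf K=0$)** Let $\psi$ be a Minkowski norm and $\phi$ a weak Minkowski norm on $\mathbb R^2$, let $\Omega=\{x:\phi(x)<1\}$, let $P(x,y)$ be the unique solution of $P=\phi(y+xP)$ for $(x,y)\in\Omega\times\mathbb R^2$, and put $$F(x,y)=\psi\big(y+xP(x,y)\big)\,\Big\{1+\sum_k x^kP_{y^k}(x,y)\Big\}.$$ * **($\mathbf K=-1$)**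 Let $\psi$ be a Minkowski norm and $\phi$ a positively $1$-homogeneous function on $\mathbb R^2$ such that $\psi+\phi$ is a weak Minkowski norm and either $\phi>\psi$ on $\mathbb R^2\setminus\{0\}$, or $-\psi<\phi<\psi$ on $\mathbb R^2\setminus\{0\}$. Let $\Omega=\{x:\phi(x)+\psi(x)<1\}$, and suppose that for every $(x,y)\in\Omega\times\mathbb R^2$ the equation $t=(\phi-\psi)(y+xt)$ has exactly one solution $t=\Phi_-(x,y)\in\mathbb R$. Let $\Phi_+(x,y)$ be the unique solution of $\Phi_+=(\phi+\psi)(y+x\Phi_+)$, and put $$F(x,y)=\tfrac12\{\Phi_+(x,y)-\Phi_-(x,y)\}.$$ Let $\mathscr O=\{x\in\Omega: F(x,\cdot)\text{ is a Minkowski norm}\}$. For $x\in\partial\mathscr O$ and $y\neq0$, say that *$y$ is tangent to $\partial\mathscr O$ at $x$* if the line $x+\mathbb Ry$ does not meet $\mathscr O$ and, for every connected component $U$ of $\mathscr O$ with $x\in\partial U$, the boundary $\partial U$ has a tangent line at $x$ (the tangent cone of $\partial U$ at $x$ is a line), and this line is spanned by $y$. **Theorem.** In each of the two cases: 1. Every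 connected component of $\mathscr O$ is an open convex set. 2. For $\mathcal H^1$-almost every $x\in\partial\mathscr O\cap\Omega$: if the matrix $\big([F^2]_{y^iy^j}(x,y)\big)$ is degenerate for some $y\ne0$, then $y$ is tangent to $\partial\mathscr O$ at $x$. In particular, if $\partial\mathscr O\cap\Omega\neq\emptyset$, then there are a point $x\in\partial\mathscr O\cap\Omega$, lying on the boundary of some connected component of $\mathscr O$, and a vector $y\neq0$, tangent to $\partial\mathscr O$ at $x$, for which this matrix is degenerate. -/

import Mathlib

open MeasureTheory Set
open scoped ContDiff

namespace Hilbert4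

noncomputable section

/-- The Euclidean plane. -/
abbrev Plane : Type := EuclideanSpace ℝ (Fin 2)

/-- Positive `1`-homogeneity. -/
def PosHomogeneous (f : Plane → ℝ) : Prop :=
  ∀ a : ℝ, 0 < a → ∀ y : Plane, f (a • y) = a * f y

/-- The matrix `([f²]_{yⁱyʲ}(y))` of second partial derivatives of `f²` at `y`. -/
def hessianSq (f : Plane → ℝ) (y : Plane) : Matrix (Fin 2) (Fin 2) ℝ :=
  Matrix.of fun i j =>
    iteratedFDeriv ℝ 2 (fun z => f z ^ 2) y
      ![EuclideanSpace.single i (1 : ℝ), EuclideanSpace.single j (1 : ℝ)]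

/-- A weak Minkowski norm: positive away from the origin, positively `1`-homogeneous (hence zero
at the origin), subadditive with equality only for vectors on a common ray, and smooth away from
the origin. -/
structure IsWeakMinkowskiNorm (f : Plane → ℝ) : Prop where
  pos : ∀ y, y ≠ 0 → 0 < f y
  homogeneous : PosHomogeneous f
  subadditive : ∀ y₁ y₂, f (y₁ + y₂) ≤ f y₁ + f y₂
  regular : ∀ y₁ y₂, f (y₁ + y₂) = f y₁ + f y₂ →
    ∃ a₁ a₂ : ℝ, 0 ≤ a₁ ∧ 0 ≤ a₂ ∧ 0 < a₁ + a₂ ∧ a₁ • y₁ = a₂ • y₂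
  smooth : ContDiffOn ℝ ∞ f {0}ᶜ

/-- A Minkowski norm: a weak Minkowski norm `f` such that the Hessian of `f²` is positive definite
away from the origin. -/
structure IsMinkowskiNorm (f : Plane → ℝ) : Prop extends IsWeakMinkowskiNorm f where
  posDef : ∀ y, y ≠ 0 → (hessianSq f y).PosDef

/-- The solution `t = Φ(x, y)` of the equation `t = φ (y + t x)`. It is the solution whenever there
is exactly one; a junk value if there is none. -/
def funkSolution (φ : Plane → ℝ) (x y : Plane) : ℝ :=
  Classical.epsilon fun t : ℝ => t = φ (y + t • x)

/-- The function `F(x, y) = ψ(y + x P(x, y)) (1 + xᵏ P_{yᵏ}(x, y))`, where `P = φ(y + x P)`. -/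
def flatF (ψ φ : Plane → ℝ) (x y : Plane) : ℝ :=
  ψ (y + funkSolution φ x y • x) * (1 + fderiv ℝ (funkSolution φ x) y x)

/-- The function `F = (Φ₊ - Φ₋) / 2`, where `Φ₊ = (φ + ψ)(y + x Φ₊)` and
`Φ₋ = (φ - ψ)(y + x Φ₋)`. -/
def hyperbolicF (ψ φ : Plane → ℝ) (x y : Plane) : ℝ :=
  (funkSolution (φ + ψ) x y - funkSolution (φ - ψ) x y) / 2

/-- The set of points `x` of `Ω` at which `F(x, ·)` is a Minkowski norm. -/
def minkowskiLocus (Ω : Set Plane) (F : Plane → Plane → ℝ) : Set Plane :=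
  {x | x ∈ Ω ∧ IsMinkowskiNorm (F x)}

/-- `U` is a connected component of the set `O`. -/
def IsComponent (O U : Set Plane) : Prop :=
  ∃ x ∈ O, U = connectedComponentIn O x

/-- The direction `y` is tangent at `x` to the boundary of a set `O` whose components are convex:
the line through `x` in direction `y` does not enter `O`, and for every component `U` of `O` with
`x ∈ ∂U` the boundary `∂U` has at `x` a tangent line (its tangent cone at `x` is a line), which
is spanned by `y`. -/
def IsTangentToBoundary (O : Set Plane) (x y : Plane) : Prop :=
  (∀ t : ℝ, x + t • y ∉ O) ∧
    ∀ U : Set Plane, IsComponent O U → x ∈ frontier U →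
      tangentConeAt ℝ (frontier U) x = (Submodule.span ℝ {y} : Submodule ℝ Plane)

end

end Hilbert4

/-!
Write `cross v w` for the determinant and `rot y` for `y` turned by a right angle. For a positive
`1`-homogeneous `f` that is smooth away from the origin, the second derivative at `y` annihilates
`y`, so it is determined by its value on `(rot y, rot y)`. Up to positive factors, this number is
also the determinant of the Hessian of `f²`, so `f` is a Minkowski norm if and only if it is
positive for all `y ≠ 0` (`PosHomogeneous.isMinkowskiNorm_iff`).

Both constructions satisfy an equation `F_x = Q_y` with a potential `Q` that is positively
`2`-homogeneous in `y`. Indeed, the solution of `Φ = g (y + x Φ)` satisfies `Φ_x = Φ Φ_y`, which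
gives `Q = P F` for curvature `0` (`projectivelyFlat_flatF`) and `Q = (Φ₊² - Φ₋²) / 4` for
curvature `-1` (`projectivelyFlat_hyperbolicF`). For curvature `-1` the equation for `Φ₋` is only
assumed to be uniquely solvable; that its solution is smooth follows, because `φ - ψ` has constant
sign and the assumption holds for all `x` in an open set (`funkAdmissible_of_unique`).

The equation `F_x = Q_y` implies that the second `y`-derivatives of `F` at `(x, y)` do not change
as `x` moves in the direction `y` (`ProjectivelyFlat.transversal_add_smul`): the derivative in
question is a radial derivative of second derivatives of `Q`, which are `0`-homogeneous. Hence
every point of `Ω` outside the set `O` where `F` is a Minkowski norm lies on a line that misses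
`O`. A line through `x ∈ Ω` in a direction in which the Hessian at `x` degenerates misses `O`, too.

The rest is plane geometry. A line that misses `O` cannot separate points of a component of `O`, so
the components are convex (`IsComponent.convex`). A convex open set has countably many boundary
points with independent normals, the normal cones having disjoint nonempty interiors
(`countable_corners`), and at all other boundary points a line that misses the set is the tangent
cone of the boundary (`tangentConeAt_frontier_eq_span`). There are countably many components, and
countable sets are null for the one-dimensional Hausdorff measure. For the existence statement, a
component that comes close to a boundary point of `O` has uncountably many boundary points nearby
(`not_countable_frontier_inter`), and at boundary points of `O` some Hessian degenerates by
continuity.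
-/

namespace Hilbert4

open Filter Topology

/-! ### Convex open sets in the plane -/

/-- The determinant of two vectors of the plane. -/
def cross (v w : Plane) : ℝ := v 0 * w 1 - v 1 * w 0

theorem cross_add_right (u v w : Plane) : cross u (v + w) = cross u v + cross u w := by
  simp [cross]; ring

theorem cross_sub_right (u v w : Plane) : cross u (v - w) = cross u v - cross u w := by
  simp [cross]; ring

theorem cross_smul_right (a : ℝ) (u v : Plane) : cross u (a • v) = a * cross u v := by
  simp [cross]; ring

theorem cross_self (u : Plane) : cross u u = 0 := by
  simp [cross]; ring

theorem cross_swap (u v : Plane) : cross u v = -cross v u := by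
  simp [cross]; ring

theorem continuous_cross : Continuous fun p : Plane × Plane => cross p.1 p.2 := by
  unfold cross; fun_prop

theorem inner_eq (v w : Plane) : inner ℝ v w = v 0 * w 0 + v 1 * w 1 := by
  simp [PiLp.inner_apply, Fin.sum_univ_two]; ring

theorem plane_ext {v w : Plane} (h0 : v 0 = w 0) (h1 : v 1 = w 1) : v = w := by
  ext i; fin_cases i <;> assumption

theorem sq_add_sq_pos {y : Plane} (hy : y ≠ 0) : 0 < y 0 ^ 2 + y 1 ^ 2 := by
  by_contra h
  apply hy
  have h0 : y 0 = 0 := by nlinarith [sq_nonneg (y 0), sq_nonneg (y 1)]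
  have h1 : y 1 = 0 := by nlinarith [sq_nonneg (y 0), sq_nonneg (y 1)]
  exact plane_ext (by simpa using h0) (by simpa using h1)

theorem exists_smul_of_cross_eq_zero {y w : Plane} (hy : y ≠ 0) (h : cross y w = 0) :
    ∃ t : ℝ, w = t • y := by
  have hp := sq_add_sq_pos hy
  refine ⟨(y 0 * w 0 + y 1 * w 1) / (y 0 ^ 2 + y 1 ^ 2), ?_⟩
  simp only [cross] at h
  apply plane_ext <;> simp <;> field_simp
  · linear_combination (-y 1) * h
  · linear_combination (y 0) * h

/-- Cramer's rule. -/
theorem cross_smul_eq (u v w : Plane) :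
    cross u v • w = cross w v • u + cross u w • v := by
  apply plane_ext <;> simp [cross] <;> ring

/-- The outer normal cone of `U` at `x`. -/
def normalCone (U : Set Plane) (x : Plane) : Set Plane :=
  {n | ∀ u ∈ U, inner ℝ n (u - x) ≤ 0}

theorem exists_inner_lt {U C : Set Plane} (hU : Convex ℝ U) (hUo : IsOpen U) (hC : Convex ℝ C)
    (hd : Disjoint U C) : ∃ n : Plane, ∀ u ∈ U, ∀ c ∈ C, inner ℝ n u < inner ℝ n c := by
  obtain ⟨f, r, h1, h2⟩ := geometric_hahn_banach_open hU hUo hC hd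
  refine ⟨(InnerProductSpace.toDual ℝ Plane).symm f, fun u hu c hc => ?_⟩
  simp only [InnerProductSpace.toDual_symm_apply]
  exact (h1 u hu).trans_le (h2 c hc)

/-- The points of `∂U` at which there are two independent normals. -/
def corners (U : Set Plane) : Set Plane :=
  {x | x ∈ frontier U ∧ ∃ n ∈ normalCone U x, ∃ m ∈ normalCone U x, cross n m ≠ 0}

/-- The normal cones at distinct corners have disjoint nonempty interiors. -/
theorem countable_corners (U : Set Plane) : (corners U).Countable := by
  have hdis : (corners U).PairwiseDisjoint fun x => interior (normalCone U x) := by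
    intro x hx x' hx' hne
    rw [Function.onFun, Set.disjoint_left]
    intro n hn hn'
    have key : ∀ z ∈ closure U, ∀ p, ∀ m ∈ normalCone U p, inner ℝ m (z - p) ≤ 0 := by
      intro z hz p m hm
      have hc : IsClosed {z : Plane | inner ℝ m (z - p) ≤ 0} :=
        isClosed_le (by fun_prop) continuous_const
      exact closure_minimal (fun u hu => hm u hu) hc hz
    have hmem : interior (normalCone U x) ∩ interior (normalCone U x') ∈ 𝓝 n :=
      (isOpen_interior.inter isOpen_interior).mem_nhds ⟨hn, hn'⟩
    have ht : Tendsto (fun t : ℝ => n + t • (x' - x)) (𝓝[>] 0) (𝓝 n) := by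
      have : Continuous fun t : ℝ => n + t • (x' - x) := by fun_prop
      have h := this.tendsto 0
      simp only [zero_smul, add_zero] at h
      exact h.mono_left nhdsWithin_le_nhds
    obtain ⟨t, ⟨h1, -⟩, ht0⟩ := ((ht.eventually hmem).and self_mem_nhdsWithin).exists
    have e1 := key x' (frontier_subset_closure hx'.1) x _ (interior_subset h1)
    have e2 := key x (frontier_subset_closure hx.1) x' n (interior_subset hn')
    have e3 : inner ℝ n (x - x') = - inner ℝ n (x' - x) := by
      rw [← neg_sub, inner_neg_right]
    have e4 : 0 < inner ℝ (x' - x) (x' - x) :=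
      real_inner_self_pos.2 (sub_ne_zero.2 hne.symm)
    rw [inner_add_left, inner_smul_left] at e1
    simp only [conj_trivial] at e1
    have : 0 < t * inner ℝ (x' - x) (x' - x) := mul_pos ht0 e4
    linarith
  refine hdis.countable_of_isOpen (fun _ _ => isOpen_interior) ?_
  rintro x ⟨-, n, hn, m, hm, hnm⟩
  have hopen : IsOpen {p : Plane | 0 < cross p m / cross n m ∧ 0 < cross n p / cross n m} := by
    refine (isOpen_lt continuous_const ?_).and (isOpen_lt continuous_const ?_)
    · exact (continuous_cross.comp (by fun_prop : Continuous fun p : Plane => (p, m))).div_const _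
    · exact (continuous_cross.comp (by fun_prop : Continuous fun p : Plane => (n, p))).div_const _
  refine ⟨n + m, interior_maximal ?_ hopen ?_⟩
  · rintro p ⟨h1, h2⟩ u hu
    have : p = (cross p m / cross n m) • n + (cross n p / cross n m) • m := by
      have h := congrArg (fun z => (cross n m)⁻¹ • z) (cross_smul_eq n m p)
      simp only [smul_smul, inv_mul_cancel₀ hnm, one_smul, smul_add] at h
      rw [div_eq_inv_mul, div_eq_inv_mul]
      exact h
    rw [this, inner_add_left, inner_smul_left, inner_smul_left]
    simp only [conj_trivial]
    nlinarith [mul_nonneg h1.le (neg_nonneg.2 (hn u hu)),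
      mul_nonneg h2.le (neg_nonneg.2 (hm u hu))]
  · have e1 : cross (n + m) m = cross n m := by simp [cross]; ring
    have e2 : cross n (n + m) = cross n m := by simp [cross]; ring
    simp [e1, e2, div_self hnm]

/-- At a boundary point which is not a corner, a line that misses `U` is annihilated by all
normals. -/
theorem inner_eq_zero_of_not_corner {U : Set Plane} (hU : Convex ℝ U) (hUo : IsOpen U)
    {x y : Plane} (hx : x ∈ frontier U) (hxc : x ∉ corners U)
    (hl : ∀ t : ℝ, x + t • y ∉ U) {m : Plane} (hm : m ∈ normalCone U x) : inner ℝ m y = 0 := by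
  have hne : U.Nonempty := by
    by_contra h
    rw [Set.not_nonempty_iff_eq_empty] at h
    simp [h] at hx
  obtain ⟨u, hu⟩ := hne
  have hC : Convex ℝ (Set.range fun t : ℝ => x + t • y) := by
    rintro _ ⟨s, rfl⟩ _ ⟨t, rfl⟩ a b _ _ hab
    refine ⟨a * s + b * t, ?_⟩
    have : x = (a + b) • x := by rw [hab, one_smul]
    simp only
    nth_rw 1 [this]
    module
  obtain ⟨n, hn⟩ := exists_inner_lt hU hUo hC (by
    rw [Set.disjoint_right]; rintro _ ⟨t, rfl⟩; exact hl t)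
  have hn' : ∀ v ∈ U, ∀ t : ℝ, inner ℝ n v < inner ℝ n x + t * inner ℝ n y := by
    intro v hv t
    have := hn v hv _ ⟨t, rfl⟩
    simpa [inner_add_right, inner_smul_right] using this
  have hny : inner ℝ n y = 0 := by
    by_contra h
    have := hn' u hu ((inner ℝ n u - inner ℝ n x) / inner ℝ n y)
    rw [div_mul_cancel₀ _ h] at this
    linarith
  have hnN : n ∈ normalCone U x := by
    intro v hv
    have := hn' v hv 0
    rw [inner_sub_right]; linarith
  have hn0 : n ≠ 0 := by
    rintro rfl
    have := hn' u hu 0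
    simp at this
  have hc : cross n m = 0 := by
    by_contra h
    exact hxc ⟨hx, n, hnN, m, hm, h⟩
  have hp := sq_add_sq_pos hn0
  rw [inner_eq] at *
  simp only [cross] at hc
  have : (n 0 ^ 2 + n 1 ^ 2) * (m 0 * y 0 + m 1 * y 1) = 0 := by
    linear_combination (n 0 * m 0 + n 1 * m 1) * hny + (n 0 * y 1 - n 1 * y 0) * hc
  exact (mul_eq_zero.1 this).resolve_left hp.ne'

/-- The direction `a y + (u - x)` points into `U` when `y` is the tangent direction. -/
theorem exists_pos_add_smul_mem {U : Set Plane} (hU : Convex ℝ U) (hUo : IsOpen U)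
    {x y u : Plane} (hN : ∀ m ∈ normalCone U x, inner ℝ m y = 0) (hu : u ∈ U) (a : ℝ) :
    ∃ ε : ℝ, 0 < ε ∧ x + ε • (a • y + (u - x)) ∈ U := by
  by_contra! h
  set v := a • y + (u - x) with hv
  have hC : Convex ℝ ((fun t : ℝ => x + t • v) '' Set.Ioi 0) := by
    rintro _ ⟨s, hs, rfl⟩ _ ⟨t, ht, rfl⟩ p q hp hq hab
    refine ⟨p * s + q * t, ?_, ?_⟩
    · exact (convex_Ioi (0 : ℝ)) hs ht hp hq hab
    · have : x = (p + q) • x := by rw [hab, one_smul]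
      simp only
      nth_rw 1 [this]
      module
  obtain ⟨n, hn⟩ := exists_inner_lt hU hUo hC (by
    rw [Set.disjoint_right]; rintro _ ⟨t, ht, rfl⟩; exact h t ht)
  have hn' : ∀ w ∈ U, ∀ t : ℝ, 0 < t → inner ℝ n w < inner ℝ n x + t * inner ℝ n v := by
    intro w hw t ht
    have := hn w hw _ ⟨t, ht, rfl⟩
    simpa [inner_add_right, inner_smul_right] using this
  have hnN : n ∈ normalCone U x := by
    intro w hw
    rw [inner_sub_right]
    have ht : Tendsto (fun t : ℝ => inner ℝ n x + t * inner ℝ n v) (𝓝[>] 0)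
        (𝓝 (inner ℝ n x + 0 * inner ℝ n v)) := by
      apply Tendsto.mono_left _ nhdsWithin_le_nhds
      have : Continuous fun t : ℝ => inner ℝ n x + t * inner ℝ n v := by fun_prop
      exact this.tendsto 0
    have := ge_of_tendsto ht (eventually_nhdsWithin_of_forall fun t ht => (hn' w hw t ht).le)
    linarith
  have h1 := hn' u hu 1 one_pos
  rw [hv, inner_add_right, inner_smul_right, hN n hnN, inner_sub_right] at h1
  linarith

theorem add_smul_mem_of_le {U : Set Plane} (hU : Convex ℝ U) (hUo : IsOpen U)
    {x v : Plane} (hx : x ∈ closure U) {ε s : ℝ} (hv : x + ε • v ∈ U) (hs : 0 < s)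
    (hsε : s ≤ ε) : x + s • v ∈ U := by
  rcases hsε.eq_or_lt with rfl | hlt
  · exact hv
  have hε : 0 < ε := hs.trans hlt
  have := hU.openSegment_closure_interior_subset_interior hx (hUo.interior_eq.symm ▸ hv)
  rw [hUo.interior_eq] at this
  apply this
  refine ⟨1 - s / ε, s / ε, by rw [sub_pos, div_lt_one hε]; exact hlt, by positivity, by ring, ?_⟩
  have : (s / ε) * ε = s := div_mul_cancel₀ _ hε.ne'
  rw [smul_add, smul_smul, this]
  module

/-- A direction that points into `U` is not in the tangent cone of `∂U`. -/
theorem notMem_tangentConeAt_of_add_smul_mem {U : Set Plane} (hU : Convex ℝ U) (hUo : IsOpen U)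
    {x v : Plane} (hx : x ∈ frontier U) {ε : ℝ} (hε : 0 < ε) (hv : x + ε • v ∈ U) :
    v ∉ tangentConeAt ℝ (frontier U) x := by
  intro hmem
  have hxU : x ∉ U := fun h => (hUo.frontier_eq ▸ hx).2 h
  have hv0 : v ≠ 0 := by
    rintro rfl
    simp at hv; exact hxU hv
  obtain ⟨α, l, hl, c, d, hd, hds, hcd⟩ := exists_fun_of_mem_tangentConeAt hmem
  have h1 : ∀ᶠ n in l, x + ε • (c n • d n) ∈ U :=
    (tendsto_const_nhds.add (hcd.const_smul ε)).eventually (hUo.mem_nhds hv)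
  have h2 : ∀ᶠ n in l, ‖d n‖ < ‖ε • (c n • d n)‖ := by
    have a := hd.norm
    have b := (hcd.const_smul ε).norm
    refine a.eventually_lt b ?_
    simp [norm_smul, hε.ne', hv0]
  obtain ⟨n, ⟨hn1, hn2⟩, hn3⟩ := ((h1.and h2).and hds).exists
  have hcl : x ∈ closure U := frontier_subset_closure hx
  have hfU : ∀ p ∈ frontier U, p ∉ U := fun p hp h => (hUo.frontier_eq ▸ hp).2 h
  rw [smul_smul] at hn1 hn2
  rw [norm_smul, Real.norm_eq_abs] at hn2
  have hd0 : 0 < ‖d n‖ := by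
    by_contra h
    have : ‖d n‖ = 0 := le_antisymm (not_lt.1 h) (norm_nonneg _)
    rw [this] at hn2; simp at hn2
  have hc1 : 1 < |ε * c n| := by
    by_contra h
    nlinarith
  rcases lt_abs.1 hc1 with h | h
  · have := add_smul_mem_of_le hU hUo hcl hn1 one_pos h.le
    rw [one_smul] at this
    exact hfU _ hn3 this
  · -- the points `x + d` and `x - d` lie on opposite sides of `x`, one of them in `U`
    have h3 : x + (-(ε * c n)) • (-d n) ∈ U := by
      rw [smul_neg, neg_smul, neg_neg]; exact hn1
    have h4 := add_smul_mem_of_le hU hUo hcl h3 one_pos h.le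
    have := hU.openSegment_closure_interior_subset_interior (frontier_subset_closure hn3)
      (hUo.interior_eq.symm ▸ h4)
    rw [hUo.interior_eq] at this
    apply hxU
    apply this
    refine ⟨1 / 2, 1 / 2, by norm_num, by norm_num, by norm_num, ?_⟩
    module

theorem neg_mem_tangentConeAt {s : Set Plane} {x v : Plane} (h : v ∈ tangentConeAt ℝ s x) :
    -v ∈ tangentConeAt ℝ s x := by
  obtain ⟨α, l, hl, c, d, hd, hds, hcd⟩ := exists_fun_of_mem_tangentConeAt h
  refine mem_tangentConeAt_of_seq l (fun n => -c n) d hd hds ?_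
  simpa using hcd.neg

theorem exists_frontier_mem_segment {U : Set Plane} (hUo : IsOpen U) {p q : Plane} (hp : p ∉ U)
    (hq : q ∈ U) : ∃ z ∈ frontier U, z ∈ segment ℝ p q := by
  by_contra! h
  have hpre : IsPreconnected (segment ℝ p q) := (convex_segment p q).isPreconnected
  have hcov : segment ℝ p q ⊆ U ∪ (closure U)ᶜ := by
    intro z hz
    by_contra hz'
    simp only [mem_union, mem_compl_iff, not_or, not_not] at hz'
    exact h z (hUo.frontier_eq ▸ ⟨hz'.2, hz'.1⟩) hz
  have hp' : p ∈ segment ℝ p q := left_mem_segment ℝ p q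
  obtain ⟨z, -, hz1, hz2⟩ := hpre U _ hUo isClosed_closure.isOpen_compl hcov
    ⟨q, right_mem_segment ℝ p q, hq⟩ ⟨p, hp', (hcov hp').resolve_left hp⟩
  exact hz2 (subset_closure hz1)

/-- At a boundary point of a convex open set which is not a corner, the tangent cone of the
boundary is the line that misses the set. -/
theorem tangentConeAt_frontier_eq_span {U : Set Plane} (hU : Convex ℝ U) (hUo : IsOpen U)
    {x y : Plane} (hx : x ∈ frontier U) (hxc : x ∉ corners U) (hy : y ≠ 0)
    (hl : ∀ t : ℝ, x + t • y ∉ U) :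
    tangentConeAt ℝ (frontier U) x = (Submodule.span ℝ {y} : Submodule ℝ Plane) := by
  have hN : ∀ m ∈ normalCone U x, inner ℝ m y = 0 := fun m hm =>
    inner_eq_zero_of_not_corner hU hUo hx hxc hl hm
  have hcl : x ∈ closure U := frontier_subset_closure hx
  obtain ⟨u, hu⟩ : U.Nonempty := closure_nonempty_iff.1 ⟨x, hcl⟩
  apply Set.Subset.antisymm
  · intro v hv
    by_contra hvs
    have hc : cross y (u - x) ≠ 0 := by
      intro h
      obtain ⟨t, ht⟩ := exists_smul_of_cross_eq_zero hy h
      exact hl t (by rw [← ht]; simpa using hu)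
    have hb : cross y v ≠ 0 := by
      intro h
      obtain ⟨t, rfl⟩ := exists_smul_of_cross_eq_zero hy h
      exact hvs (Submodule.smul_mem _ _ (Submodule.mem_span_singleton_self y))
    have hdec : v = (cross v (u - x) / cross y (u - x)) • y
        + (cross y v / cross y (u - x)) • (u - x) := by
      have h := congrArg (fun z => (cross y (u - x))⁻¹ • z) (cross_smul_eq y (u - x) v)
      simp only [smul_smul, inv_mul_cancel₀ hc, one_smul, smul_add] at h
      rw [div_eq_inv_mul, div_eq_inv_mul]
      exact h
    set a := cross v (u - x) / cross y (u - x)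
    have hb' : cross y v / cross y (u - x) ≠ 0 := div_ne_zero hb hc
    set b := cross y v / cross y (u - x)
    have main : ∀ (w : Plane) (a' b' : ℝ), 0 < b' → w = a' • y + b' • (u - x) →
        w ∈ tangentConeAt ℝ (frontier U) x → False := by
      intro w a' b' hb0 hw hmem
      obtain ⟨ε, hε, he⟩ := exists_pos_add_smul_mem hU hUo hN hu (a' / b')
      refine notMem_tangentConeAt_of_add_smul_mem hU hUo hx (ε := ε / b') (by positivity) ?_ hmem
      rw [hw]
      convert he using 2
      rw [smul_add, smul_add, smul_smul, smul_smul, smul_smul, div_mul_cancel₀ _ hb0.ne']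
      congr 2
      ring
    rcases lt_or_gt_of_ne hb' with h | h
    · refine main (-v) (-a) (-b) (by linarith) ?_ (neg_mem_tangentConeAt hv)
      nth_rw 1 [hdec]; module
    · exact main v a b h hdec hv
  · intro v hv
    obtain ⟨a, rfl⟩ := Submodule.mem_span_singleton.1 hv
    -- near `x`, the boundary crosses each narrow sector between `a y` and `a y + η (u - x)`
    have key : ∀ k : ℕ, ∃ s : ℝ, 0 < s ∧ s ≤ 1 / ((k : ℝ) + 1) ∧ ∃ δ : ℝ, 0 ≤ δ ∧
        δ ≤ 1 / ((k : ℝ) + 1) ∧ x + s • (a • y + δ • (u - x)) ∈ frontier U := by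
      intro k
      have hk : (0 : ℝ) < 1 / ((k : ℝ) + 1) := by positivity
      set η := 1 / ((k : ℝ) + 1) with hη
      obtain ⟨ε, hε, he⟩ := exists_pos_add_smul_mem hU hUo hN hu (a / η)
      have he' : x + (ε / η) • (a • y + η • (u - x)) ∈ U := by
        convert he using 2
        rw [smul_add, smul_add, smul_smul, smul_smul, smul_smul, div_mul_cancel₀ _ hk.ne']
        congr 2
        ring
      set s := min (ε / η) η
      have hs : 0 < s := lt_min (by positivity) hk
      have hmem := add_smul_mem_of_le hU hUo hcl he' hs (min_le_left _ _)
      have hnot : x + s • (a • y) ∉ U := by rw [smul_smul]; exact hl _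
      obtain ⟨z, hz, p, q, hp, hq, hpq, rfl⟩ := exists_frontier_mem_segment hUo hnot hmem
      refine ⟨s, hs, min_le_right _ _, q * η, by positivity, ?_, ?_⟩
      · nlinarith
      · convert hz using 1
        have : p = 1 - q := by linarith
        subst this
        module
    choose s hs0 hs1 δ hδ0 hδ1 hmem using key
    have hz : Tendsto (fun k : ℕ => 1 / ((k : ℝ) + 1)) atTop (𝓝 0) :=
      tendsto_one_div_add_atTop_nhds_zero_nat
    have hs : Tendsto s atTop (𝓝 0) :=
      squeeze_zero (fun k => (hs0 k).le) hs1 hz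
    have hδ : Tendsto δ atTop (𝓝 0) := squeeze_zero hδ0 hδ1 hz
    have hdir : Tendsto (fun k => a • y + δ k • (u - x)) atTop (𝓝 (a • y)) := by
      simpa using (tendsto_const_nhds (x := a • y)).add (hδ.smul_const (u - x))
    refine mem_tangentConeAt_of_seq atTop (fun k => (s k)⁻¹)
      (fun k => s k • (a • y + δ k • (u - x))) ?_ (Eventually.of_forall hmem) ?_
    · simpa using hs.smul hdir
    · refine hdir.congr fun k => ?_
      rw [smul_smul, inv_mul_cancel₀ (hs0 k).ne', one_smul]

/-- A neighbourhood of a point outside a convex open set `U`, if it meets `U`, meets `∂U` in an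
uncountable set: the rays from an exterior point to the points of a short segment in `U` cross `∂U`
at different points. -/
theorem not_countable_frontier_inter {U B : Set Plane} (hU : Convex ℝ U) (hUo : IsOpen U)
    (hB : Convex ℝ B) (hBo : IsOpen B) (h1 : (U ∩ B).Nonempty) (h2 : ∃ x ∈ B, x ∉ U) :
    ¬ (frontier U ∩ B).Countable := by
  obtain ⟨p, hpU, hpB⟩ := h1
  obtain ⟨x, hxB, hxU⟩ := h2
  have hint : interior (closure U) = U := by
    rw [hU.interior_closure_eq_interior_of_nonempty_interior, hUo.interior_eq]
    rw [hUo.interior_eq]; exact ⟨p, hpU⟩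
  obtain ⟨q, hqB, hqU⟩ : ∃ q ∈ B, q ∉ closure U := by
    by_contra! h
    exact hxU (hint ▸ interior_maximal h hBo hxB)
  intro hcount
  have hqp : p - q ≠ 0 := by
    intro h
    exact hqU (subset_closure (sub_eq_zero.1 h ▸ hpU))
  set w : Plane := !₂[-(p - q) 1, (p - q) 0] with hw
  have hcw : cross (p - q) w ≠ 0 := by
    have := sq_add_sq_pos hqp
    simp [cross, hw] at this ⊢
    nlinarith
  have hnear : ∀ᶠ t : ℝ in 𝓝 0, p + t • w ∈ U ∩ B := by
    have hc : Continuous fun t : ℝ => p + t • w := by fun_prop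
    have := hc.tendsto 0
    simp only [zero_smul, add_zero] at this
    exact this.eventually ((hUo.inter hBo).mem_nhds ⟨hpU, hpB⟩)
  obtain ⟨r, hr, hball⟩ := Metric.eventually_nhds_iff_ball.1 hnear
  have hsel : ∀ t : ℝ, t ∈ Metric.ball (0 : ℝ) r →
      ∃ z ∈ frontier U ∩ B, ∃ c : ℝ, c ≠ 0 ∧ z = q + c • (p - q + t • w) := by
    intro t ht
    have hm := hball t ht
    obtain ⟨z, hz, a, b, ha, hb, hab, rfl⟩ :=
      exists_frontier_mem_segment hUo (fun h => hqU (subset_closure h)) hm.1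
    refine ⟨_, ⟨hz, hB hqB hm.2 ha hb hab⟩, b, ?_, ?_⟩
    · rintro rfl
      have : a = 1 := by linarith
      subst this
      simp at hz
      exact hqU (frontier_subset_closure hz)
    · have : a = 1 - b := by linarith
      subst this
      module
  choose! z hz c hc hzc using hsel
  have hinj : Set.InjOn z (Metric.ball (0 : ℝ) r) := by
    intro t ht t' ht' h
    have h' : c t • (p - q + t • w) = c t' • (p - q + t' • w) := by
      have := hzc t ht ▸ hzc t' ht' ▸ h
      exact add_left_cancel this
    have e1 := congrArg (cross (p - q)) h'
    have e2 := congrArg (cross w) h'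
    simp only [cross_smul_right, cross_add_right, cross_self, mul_zero, add_zero, zero_add] at e1 e2
    have hcw' : cross w (p - q) ≠ 0 := by rw [cross_swap]; simpa using hcw
    have e3 : c t = c t' := mul_right_cancel₀ hcw' e2
    rw [e3] at e1
    have := mul_left_cancel₀ (hc t' ht') e1
    exact mul_right_cancel₀ hcw this
  have himg : (z '' Metric.ball (0 : ℝ) r).Countable :=
    hcount.mono (by rintro _ ⟨t, ht, rfl⟩; exact hz t ht)
  have := (Set.countable_of_injective_of_countable_image hinj himg)
  rw [Real.ball_eq_Ioo] at this
  exact (Cardinal.Real.Ioo_countable_iff.1 this).not_gt (by linarith)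

/-! ### Complements of families of lines -/

theorem IsComponent.subset {O U : Set Plane} (h : IsComponent O U) : U ⊆ O := by
  obtain ⟨x, -, rfl⟩ := h
  exact connectedComponentIn_subset O x

theorem IsComponent.isOpen {O U : Set Plane} (hO : IsOpen O) (h : IsComponent O U) : IsOpen U := by
  obtain ⟨x, -, rfl⟩ := h
  exact hO.connectedComponentIn

theorem IsComponent.eq_of_mem {O U V : Set Plane} (hU : IsComponent O U) (hV : IsComponent O V)
    {z : Plane} (h1 : z ∈ U) (h2 : z ∈ V) : U = V := by
  obtain ⟨x, -, rfl⟩ := hU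
  obtain ⟨y, -, rfl⟩ := hV
  rw [connectedComponentIn_eq h1, connectedComponentIn_eq h2]

/-- If each point of the convex set `Ω` outside `O` lies on a line that misses `O`, then the
components of `O` are convex: none of these lines separates points of a component. -/
theorem IsComponent.convex {Ω O U : Set Plane} (hΩ : Convex ℝ Ω) (hOΩ : O ⊆ Ω)
    (hline : ∀ x ∈ Ω, x ∉ O → ∃ y, y ≠ 0 ∧ ∀ t : ℝ, x + t • y ∉ O) (h : IsComponent O U) :
    Convex ℝ U := by
  have hUO := h.subset
  have hhull : convexHull ℝ U ⊆ O := by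
    intro z hz
    by_contra hzO
    have hzΩ : z ∈ Ω := convexHull_min (hUO.trans hOΩ) hΩ hz
    obtain ⟨y, hy, hl⟩ := hline z hzΩ hzO
    have hne : ∀ u ∈ U, cross y u ≠ cross y z := by
      intro u hu heq
      obtain ⟨t, ht⟩ := exists_smul_of_cross_eq_zero hy
        (show cross y (u - z) = 0 by rw [cross_sub_right, heq, sub_self])
      exact hl t (by rw [← ht, add_sub_cancel]; exact hUO hu)
    have hpre : IsPreconnected U := by
      obtain ⟨x, -, rfl⟩ := h
      exact isPreconnected_connectedComponentIn
    have hcont : Continuous fun u : Plane => cross y u :=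
      continuous_cross.comp (by fun_prop : Continuous fun p : Plane => (y, p))
    have hlin : IsLinearMap ℝ fun u : Plane => cross y u :=
      ⟨cross_add_right y, fun a u => cross_smul_right a y u⟩
    have hside : (∀ u ∈ U, cross y u < cross y z) ∨ (∀ u ∈ U, cross y z < cross y u) := by
      by_contra! hh
      obtain ⟨⟨u, hu, hu'⟩, v, hv, hv'⟩ := hh
      obtain ⟨w, hw, hw'⟩ := hpre.intermediate_value hv hu hcont.continuousOn ⟨hv', hu'⟩
      exact hne w hw hw'
    rcases hside with hs | hs
    · exact lt_irrefl (cross y z) (convexHull_min (t := {u | cross y u < cross y z}) hs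
        (convex_halfSpace_lt hlin _) hz)
    · exact lt_irrefl (cross y z) (convexHull_min (t := {u | cross y z < cross y u}) hs
        (convex_halfSpace_gt hlin _) hz)
  obtain ⟨x, hx, rfl⟩ := h
  have : convexHull ℝ (connectedComponentIn O x) ⊆ connectedComponentIn O x :=
    (convex_convexHull ℝ _).isPreconnected.subset_connectedComponentIn
      (subset_convexHull ℝ _ (mem_connectedComponentIn hx)) hhull
  rw [← this.antisymm (subset_convexHull ℝ _)]
  exact convex_convexHull ℝ _

theorem countable_components {O : Set Plane} (hO : IsOpen O) :
    {U | IsComponent O U}.Countable := by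
  have hdis : {U | IsComponent O U}.PairwiseDisjoint id := by
    intro U hU V hV hne
    rw [Function.onFun, Set.disjoint_left]
    exact fun z h1 h2 => hne (hU.eq_of_mem hV h1 h2)
  refine hdis.countable_of_isOpen (fun U hU => IsComponent.isOpen hO hU) ?_
  rintro _ ⟨x, hx, rfl⟩
  exact ⟨x, mem_connectedComponentIn hx⟩

/-- The corners of all components of `O`. -/
def componentCorners (O : Set Plane) : Set Plane :=
  ⋃ U ∈ {U | IsComponent O U}, corners U

theorem countable_componentCorners {O : Set Plane} (hO : IsOpen O) :
    (componentCorners O).Countable :=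
  (countable_components hO).biUnion fun U _ => countable_corners U

theorem isTangentToBoundary_of_notMem_componentCorners {Ω O : Set Plane} (hΩ : Convex ℝ Ω)
    (hO : IsOpen O) (hOΩ : O ⊆ Ω)
    (hline : ∀ x ∈ Ω, x ∉ O → ∃ y, y ≠ 0 ∧ ∀ t : ℝ, x + t • y ∉ O)
    {x y : Plane} (hx : x ∉ componentCorners O) (hy : y ≠ 0) (hl : ∀ t : ℝ, x + t • y ∉ O) :
    IsTangentToBoundary O x y := by
  refine ⟨hl, fun U hU hxU => ?_⟩
  refine tangentConeAt_frontier_eq_span (hU.convex hΩ hOΩ hline) (hU.isOpen hO) hxU ?_ hy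
    fun t h => hl t (hU.subset h)
  intro hc
  exact hx (Set.mem_biUnion (show U ∈ {U | IsComponent O U} from hU) hc)

theorem exists_mem_frontier_component {Ω O : Set Plane} (hΩ : Convex ℝ Ω) (hΩo : IsOpen Ω)
    (hO : IsOpen O) (hOΩ : O ⊆ Ω)
    (hline : ∀ x ∈ Ω, x ∉ O → ∃ y, y ≠ 0 ∧ ∀ t : ℝ, x + t • y ∉ O)
    (hne : (frontier O ∩ Ω).Nonempty) :
    ∃ x ∈ frontier O ∩ Ω, x ∉ componentCorners O ∧ ∃ U, IsComponent O U ∧ x ∈ frontier U := by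
  obtain ⟨x₀, hx₀, hx₀Ω⟩ := hne
  obtain ⟨r, hr, hball⟩ := Metric.isOpen_iff.1 hΩo x₀ hx₀Ω
  obtain ⟨p, hp, hpB⟩ := Metric.mem_closure_iff.1 (frontier_subset_closure hx₀) r hr
  have hx₀O : x₀ ∉ O := (hO.frontier_eq ▸ hx₀).2
  have hU : IsComponent O (connectedComponentIn O p) := ⟨p, hp, rfl⟩
  set U := connectedComponentIn O p with hUdef
  have hunc := not_countable_frontier_inter (B := Metric.ball x₀ r) (hU.convex hΩ hOΩ hline)
    (hU.isOpen hO) (convex_ball x₀ r) Metric.isOpen_ball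
    ⟨p, mem_connectedComponentIn hp, by rw [Metric.mem_ball, dist_comm]; exact hpB⟩
    ⟨x₀, Metric.mem_ball_self hr, fun h => hx₀O (hU.subset h)⟩
  obtain ⟨x, ⟨hxU, hxB⟩, hxc⟩ : ∃ x ∈ frontier U ∩ Metric.ball x₀ r, x ∉ componentCorners O := by
    by_contra! h
    exact hunc ((countable_componentCorners hO).mono h)
  refine ⟨x, ⟨?_, hball hxB⟩, hxc, U, hU, hxU⟩
  rw [hO.frontier_eq]
  refine ⟨closure_mono hU.subset (frontier_subset_closure hxU), fun hxO => ?_⟩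
  have hV : IsComponent O (connectedComponentIn O x) := ⟨x, hxO, rfl⟩
  obtain ⟨z, hz1, hz2⟩ := mem_closure_iff.1 (frontier_subset_closure hxU) _ (hV.isOpen hO)
    (mem_connectedComponentIn hxO)
  have := hV.eq_of_mem hU hz1 hz2
  rw [(hU.isOpen hO).frontier_eq] at hxU
  exact hxU.2 (this ▸ mem_connectedComponentIn hxO)

/-! ### Minkowski norms in terms of one second derivative -/

theorem PosHomogeneous.map_zero {f : Plane → ℝ} (hf : PosHomogeneous f) : f 0 = 0 := by
  have := hf 2 two_pos 0
  rw [smul_zero] at this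
  linarith

/-- The derivative of `f` in the direction `u`, as a function of the point. -/
noncomputable def dirDeriv {E : Type*} [NormedAddCommGroup E] [NormedSpace ℝ E] (u : E) (f : E → ℝ) (p : E) : ℝ :=
  fderiv ℝ f p u

section DirDeriv

variable {E : Type*} [NormedAddCommGroup E] [NormedSpace ℝ E] {S : Set E} {f g : E → ℝ}

theorem contDiffOn_dirDeriv (hS : IsOpen S) (hf : ContDiffOn ℝ ∞ f S) (u : E) :
    ContDiffOn ℝ ∞ (dirDeriv u f) S :=
  (hf.fderiv_of_isOpen hS (by simp)).clm_apply contDiffOn_const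

theorem dirDeriv_congr (hS : IsOpen S) (h : Set.EqOn f g S) (u : E) :
    Set.EqOn (dirDeriv u f) (dirDeriv u g) S := fun p hp => by
  have : f =ᶠ[𝓝 p] g := h.eventuallyEq_of_mem (hS.mem_nhds hp)
  simp only [dirDeriv, this.fderiv_eq]

theorem dirDeriv_dirDeriv_eq (hS : IsOpen S) (hf : ContDiffOn ℝ ∞ f S) (u v : E) {p : E}
    (hp : p ∈ S) : dirDeriv u (dirDeriv v f) p = fderiv ℝ (fderiv ℝ f) p u v := by
  have hd : DifferentiableAt ℝ (fderiv ℝ f) p :=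
    ((hf.fderiv_of_isOpen hS (m := ∞) (by simp)).contDiffAt (hS.mem_nhds hp)).differentiableAt
      (by simp)
  have h := hd.hasFDerivAt.clm_apply (hasFDerivAt_const v p)
  have h2 : fderiv ℝ (dirDeriv v f) p = _ := h.fderiv
  rw [dirDeriv, h2]
  simp

theorem dirDeriv_comm (hS : IsOpen S) (hf : ContDiffOn ℝ ∞ f S) (u v : E) :
    Set.EqOn (dirDeriv u (dirDeriv v f)) (dirDeriv v (dirDeriv u f)) S := fun p hp => by
  rw [dirDeriv_dirDeriv_eq hS hf u v hp, dirDeriv_dirDeriv_eq hS hf v u hp]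
  exact (hf.contDiffAt (hS.mem_nhds hp)).isSymmSndFDerivAt
    (by rw [minSmoothness_of_isRCLikeNormedField]; exact ENat.LEInfty.out) u v

end DirDeriv

/-- The rotation by a right angle. -/
def rot (y : Plane) : Plane := !₂[-y 1, y 0]

theorem isOpen_compl_zero : IsOpen ({0}ᶜ : Set Plane) := isOpen_compl_singleton

section Homogeneous

variable {f : Plane → ℝ}

theorem differentiableAt_of_smooth (hs : ContDiffOn ℝ ∞ f {0}ᶜ) {y : Plane} (hy : y ≠ 0) :
    DifferentiableAt ℝ f y :=
  (hs.contDiffAt (isOpen_compl_zero.mem_nhds hy)).differentiableAt (by simp)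

/-- Euler's identity. -/
theorem PosHomogeneous.fderiv_self (hf : PosHomogeneous f) (hs : ContDiffOn ℝ ∞ f {0}ᶜ)
    {y : Plane} (hy : y ≠ 0) : fderiv ℝ f y y = f y := by
  have h1 : HasDerivAt (fun t : ℝ => y + t • y) y 0 := by
    simpa using ((hasDerivAt_id (0 : ℝ)).smul_const y).const_add y
  have hd : HasFDerivAt f (fderiv ℝ f y) (y + (0 : ℝ) • y) := by
    simpa using (differentiableAt_of_smooth hs hy).hasFDerivAt
  have h2 := hd.comp_hasDerivAt (0 : ℝ) h1
  have h3 : HasDerivAt (fun t : ℝ => (1 + t) * f y) (f y) 0 := by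
    simpa using ((hasDerivAt_id (0 : ℝ)).const_add 1).mul_const (f y)
  have h4 : (f ∘ fun t : ℝ => y + t • y) =ᶠ[𝓝 0] fun t : ℝ => (1 + t) * f y := by
    filter_upwards [lt_mem_nhds (show (-1 : ℝ) < 0 by norm_num)] with t ht
    have := hf (1 + t) (by linarith) y
    rw [add_smul, one_smul] at this
    exact this
  exact h2.unique (h3.congr_of_eventuallyEq h4)

/-- The second derivative of a `1`-homogeneous function has the radial direction in its kernel. -/
theorem PosHomogeneous.fderiv_fderiv_self (hf : PosHomogeneous f) (hs : ContDiffOn ℝ ∞ f {0}ᶜ)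
    {y : Plane} (hy : y ≠ 0) (u : Plane) : fderiv ℝ (fderiv ℝ f) y u y = 0 := by
  have hd : DifferentiableAt ℝ (fderiv ℝ f) y :=
    ((hs.fderiv_of_isOpen isOpen_compl_zero (m := ∞) (by simp)).contDiffAt
      (isOpen_compl_zero.mem_nhds hy)).differentiableAt (by simp)
  have h1 : HasFDerivAt (fun z : Plane => fderiv ℝ f z (id z)) _ y :=
    hd.hasFDerivAt.clm_apply (hasFDerivAt_id y)
  have h2 : (fun z : Plane => fderiv ℝ f z (id z)) =ᶠ[𝓝 y] f := by
    filter_upwards [isOpen_compl_zero.mem_nhds hy] with z hz using hf.fderiv_self hs hz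
  have h3 := h2.fderiv_eq (𝕜 := ℝ)
  rw [h1.fderiv] at h3
  have := congrArg (fun L : Plane →L[ℝ] ℝ => L u) h3
  simpa using this

theorem fderiv_fderiv_symm (hs : ContDiffOn ℝ ∞ f {0}ᶜ) {y : Plane} (hy : y ≠ 0) (u v : Plane) :
    fderiv ℝ (fderiv ℝ f) y u v = fderiv ℝ (fderiv ℝ f) y v u :=
  (hs.contDiffAt (isOpen_compl_zero.mem_nhds hy)).isSymmSndFDerivAt
    (by rw [minSmoothness_of_isRCLikeNormedField]; exact ENat.LEInfty.out) u v

/-- The second derivative of a `1`-homogeneous function at `y` is a multiple of the square of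
`cross y`. -/
theorem PosHomogeneous.sq_mul_fderiv_fderiv (hf : PosHomogeneous f) (hs : ContDiffOn ℝ ∞ f {0}ᶜ)
    {y : Plane} (hy : y ≠ 0) (u v : Plane) :
    (y 0 ^ 2 + y 1 ^ 2) ^ 2 * fderiv ℝ (fderiv ℝ f) y u v =
      fderiv ℝ (fderiv ℝ f) y (rot y) (rot y) * (cross y u * cross y v) := by
  have hdec : ∀ u : Plane, (y 0 ^ 2 + y 1 ^ 2) • u =
      (y 0 * u 0 + y 1 * u 1) • y + cross y u • rot y := by
    intro u
    apply plane_ext <;> simp [cross, rot] <;> ring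
  have h1 : fderiv ℝ (fderiv ℝ f) y ((y 0 ^ 2 + y 1 ^ 2) • u) ((y 0 ^ 2 + y 1 ^ 2) • v) =
      fderiv ℝ (fderiv ℝ f) y (rot y) (rot y) * (cross y u * cross y v) := by
    rw [hdec u, hdec v]
    simp only [map_add, map_smul, add_apply, smul_apply, smul_eq_mul,
      hf.fderiv_fderiv_self hs hy, fderiv_fderiv_symm hs hy y]
    ring
  rw [← h1]
  simp only [map_smul, smul_apply, smul_eq_mul]
  ring

theorem fderiv_fderiv_sq (hs : ContDiffOn ℝ ∞ f {0}ᶜ) {y : Plane} (hy : y ≠ 0) (u v : Plane) :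
    iteratedFDeriv ℝ 2 (fun z => f z ^ 2) y ![u, v] =
      2 * (f y * fderiv ℝ (fderiv ℝ f) y u v + fderiv ℝ f y u * fderiv ℝ f y v) := by
  have hd1 : DifferentiableAt ℝ f y := differentiableAt_of_smooth hs hy
  have hd : DifferentiableAt ℝ (fderiv ℝ f) y :=
    ((hs.fderiv_of_isOpen isOpen_compl_zero (m := ∞) (by simp)).contDiffAt
      (isOpen_compl_zero.mem_nhds hy)).differentiableAt (by simp)
  have h1 : fderiv ℝ (fun z => f z ^ 2) =ᶠ[𝓝 y] fun z => (2 * f z) • fderiv ℝ f z := by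
    filter_upwards [isOpen_compl_zero.mem_nhds hy] with z hz
    have := (differentiableAt_of_smooth hs hz).hasFDerivAt.pow 2
    rw [this.fderiv]
    simp
  have h2 : HasFDerivAt (fun z => (2 * f z) • fderiv ℝ f z) _ y :=
    (hd1.hasFDerivAt.const_mul 2).smul hd.hasFDerivAt
  rw [iteratedFDeriv_two_apply, h1.fderiv_eq, h2.fderiv]
  simp
  ring


theorem PosHomogeneous.hessianSq_apply (hf : PosHomogeneous f) (hs : ContDiffOn ℝ ∞ f {0}ᶜ)
    {y : Plane} (hy : y ≠ 0) (i j : Fin 2) :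
    hessianSq f y i j = 2 * (f y * (fderiv ℝ (fderiv ℝ f) y (rot y) (rot y) /
      (y 0 ^ 2 + y 1 ^ 2) ^ 2) * (cross y (EuclideanSpace.single i 1) *
        cross y (EuclideanSpace.single j 1)) +
      fderiv ℝ f y (EuclideanSpace.single i 1) * fderiv ℝ f y (EuclideanSpace.single j 1)) := by
  have hp := sq_add_sq_pos hy
  have := hf.sq_mul_fderiv_fderiv hs hy (EuclideanSpace.single i 1) (EuclideanSpace.single j 1)
  rw [hessianSq, Matrix.of_apply, fderiv_fderiv_sq hs hy]
  rw [mul_assoc (f y), div_mul_eq_mul_div, ← this]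
  field_simp

theorem PosHomogeneous.euler_coords (hf : PosHomogeneous f) (hs : ContDiffOn ℝ ∞ f {0}ᶜ)
    {y : Plane} (hy : y ≠ 0) : f y = y 0 * fderiv ℝ f y (EuclideanSpace.single 0 1) +
      y 1 * fderiv ℝ f y (EuclideanSpace.single 1 1) := by
  have hdec : y = y 0 • EuclideanSpace.single (0 : Fin 2) (1 : ℝ) +
      y 1 • EuclideanSpace.single (1 : Fin 2) (1 : ℝ) := by
    apply plane_ext <;> simp
  have h := hf.fderiv_self hs hy
  rw [← h]
  nth_rw 2 [hdec]
  simp only [map_add, map_smul, smul_eq_mul]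

theorem PosHomogeneous.det_hessianSq (hf : PosHomogeneous f) (hs : ContDiffOn ℝ ∞ f {0}ᶜ)
    {y : Plane} (hy : y ≠ 0) : (hessianSq f y).det =
      4 * f y ^ 3 * (fderiv ℝ (fderiv ℝ f) y (rot y) (rot y) / (y 0 ^ 2 + y 1 ^ 2) ^ 2) := by
  rw [Matrix.det_fin_two]
  simp only [hf.hessianSq_apply hs hy]
  have he := hf.euler_coords hs hy
  have c0 : cross y (EuclideanSpace.single 0 1) = -y 1 := by simp [cross]
  have c1 : cross y (EuclideanSpace.single 1 1) = y 0 := by simp [cross]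
  rw [c0, c1]
  generalize fderiv ℝ (fderiv ℝ f) y (rot y) (rot y) / (y 0 ^ 2 + y 1 ^ 2) ^ 2 = m
  generalize fderiv ℝ f y (EuclideanSpace.single 0 1) = p at *
  generalize fderiv ℝ f y (EuclideanSpace.single 1 1) = q at *
  rw [he]
  ring

theorem PosHomogeneous.det_hessianSq_eq_zero_iff (hf : PosHomogeneous f)
    (hpos : ∀ y, y ≠ 0 → 0 < f y) (hs : ContDiffOn ℝ ∞ f {0}ᶜ) {y : Plane} (hy : y ≠ 0) :
    (hessianSq f y).det = 0 ↔ fderiv ℝ (fderiv ℝ f) y (rot y) (rot y) = 0 := by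
  have hp := sq_add_sq_pos hy
  have h := hpos y hy
  rw [hf.det_hessianSq hs hy]
  simp [h.ne', hp.ne']

theorem PosHomogeneous.posDef_hessianSq_iff (hf : PosHomogeneous f)
    (hpos : ∀ y, y ≠ 0 → 0 < f y) (hs : ContDiffOn ℝ ∞ f {0}ᶜ) {y : Plane} (hy : y ≠ 0) :
    (hessianSq f y).PosDef ↔ 0 < fderiv ℝ (fderiv ℝ f) y (rot y) (rot y) := by
  have hp := sq_add_sq_pos hy
  have hfy := hpos y hy
  constructor
  · intro h
    have := h.det_pos
    rw [hf.det_hessianSq hs hy] at this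
    have h2 : 0 < fderiv ℝ (fderiv ℝ f) y (rot y) (rot y) / (y 0 ^ 2 + y 1 ^ 2) ^ 2 :=
      pos_of_mul_pos_right this (by positivity)
    exact (div_pos_iff_of_pos_right (by positivity)).1 h2
  · intro h
    have hm : 0 < fderiv ℝ (fderiv ℝ f) y (rot y) (rot y) / (y 0 ^ 2 + y 1 ^ 2) ^ 2 := by
      positivity
    have he := hf.euler_coords hs hy
    have c0 : cross y (EuclideanSpace.single 0 1) = -y 1 := by simp [cross]
    have c1 : cross y (EuclideanSpace.single 1 1) = y 0 := by simp [cross]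
    refine Matrix.PosDef.of_dotProduct_mulVec_pos ?_ ?_
    · ext i j
      simp only [Matrix.conjTranspose_apply, star_trivial, hf.hessianSq_apply hs hy]
      ring
    · intro v hv
      simp only [Matrix.mulVec, dotProduct, Fin.sum_univ_two, hf.hessianSq_apply hs hy, c0, c1,
        Pi.star_apply, star_trivial]
      generalize fderiv ℝ (fderiv ℝ f) y (rot y) (rot y) / (y 0 ^ 2 + y 1 ^ 2) ^ 2 = m at *
      generalize fderiv ℝ f y (EuclideanSpace.single 0 1) = p at *
      generalize fderiv ℝ f y (EuclideanSpace.single 1 1) = q at *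
      have hform : 0 < f y * m * (y 0 * v 1 - y 1 * v 0) ^ 2 + (p * v 0 + q * v 1) ^ 2 := by
        by_cases hc : y 0 * v 1 - y 1 * v 0 = 0
        · have h1 : f y * v 0 = y 0 * (p * v 0 + q * v 1) := by
            rw [he]; linear_combination (-q) * hc
          have h2 : f y * v 1 = y 1 * (p * v 0 + q * v 1) := by
            rw [he]; linear_combination p * hc
          have h3 : p * v 0 + q * v 1 ≠ 0 := by
            intro h0
            rw [h0, mul_zero, mul_eq_zero] at h1 h2
            apply hv
            ext i
            fin_cases i
            · exact h1.resolve_left hfy.ne'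
            · exact h2.resolve_left hfy.ne'
          positivity
        · positivity
      linarith

theorem hasDerivAt_line_of_smooth (hs : ContDiffOn ℝ ∞ f {0}ᶜ) (a d : Plane) {t : ℝ}
    (h : a + t • d ≠ 0) : HasDerivAt (fun s : ℝ => f (a + s • d)) (fderiv ℝ f (a + t • d) d) t := by
  have h1 : HasDerivAt (fun s : ℝ => a + s • d) d t := by
    simpa using ((hasDerivAt_id t).smul_const d).const_add a
  exact (differentiableAt_of_smooth hs h).hasFDerivAt.comp_hasDerivAt t h1

/-- A `1`-homogeneous function with positive transversal second derivative is strictly convex on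
lines that miss the origin. -/
theorem PosHomogeneous.strictConvexOn_line (hf : PosHomogeneous f) (hs : ContDiffOn ℝ ∞ f {0}ᶜ)
    (h2 : ∀ y, y ≠ 0 → 0 < fderiv ℝ (fderiv ℝ f) y (rot y) (rot y)) {a d : Plane}
    (hc : cross a d ≠ 0) : StrictConvexOn ℝ univ fun t : ℝ => f (a + t • d) := by
  have hne : ∀ t : ℝ, a + t • d ≠ 0 := by
    intro t ht
    apply hc
    have h1 : cross (a + t • d) d = cross a d := by simp [cross]; ring
    rw [← h1, ht]
    simp [cross]
  have hd1 : deriv (fun t : ℝ => f (a + t • d)) = fun t => fderiv ℝ f (a + t • d) d := by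
    ext t
    exact (hasDerivAt_line_of_smooth hs a d (hne t)).deriv
  refine strictConvexOn_univ_of_deriv2_pos ?_ ?_
  · exact continuous_iff_continuousAt.2 fun t =>
      (hasDerivAt_line_of_smooth hs a d (hne t)).continuousAt
  · intro t
    have hdd : DifferentiableAt ℝ (fderiv ℝ f) (a + t • d) :=
      ((hs.fderiv_of_isOpen isOpen_compl_zero (m := ∞) (by simp)).contDiffAt
        (isOpen_compl_zero.mem_nhds (hne t))).differentiableAt (by simp)
    have h1 : HasDerivAt (fun s : ℝ => a + s • d) d t := by
      simpa using ((hasDerivAt_id t).smul_const d).const_add a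
    have h3 : HasDerivAt (fun s : ℝ => fderiv ℝ f (a + s • d) d)
        (fderiv ℝ (fderiv ℝ f) (a + t • d) d d) t := by
      have h5 : HasFDerivAt (fun z => fderiv ℝ f z d)
          ((fderiv ℝ (fderiv ℝ f) (a + t • d)).flip d) (a + t • d) := by
        have := hdd.hasFDerivAt.clm_apply (hasFDerivAt_const d (a + t • d))
        simpa using this
      exact h5.comp_hasDerivAt t h1
    have h4 : deriv^[2] (fun t : ℝ => f (a + t • d)) t = fderiv ℝ (fderiv ℝ f) (a + t • d) d d := by
      change deriv (deriv fun t : ℝ => f (a + t • d)) t = _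
      rw [hd1, h3.deriv]
    rw [h4]
    have h5 := hf.sq_mul_fderiv_fderiv hs (hne t) d d
    have h6 : cross (a + t • d) d = cross a d := by simp [cross]; ring
    rw [h6] at h5
    have hp := sq_add_sq_pos (hne t)
    have h7 := h2 _ (hne t)
    have h8 : 0 < cross a d * cross a d := mul_self_pos.2 hc
    refine pos_of_mul_pos_right (a := ((a + t • d) 0 ^ 2 + (a + t • d) 1 ^ 2) ^ 2) ?_ (by positivity)
    rw [h5]
    positivity

theorem PosHomogeneous.add_lt_of_cross_ne_zero (hf : PosHomogeneous f)
    (hs : ContDiffOn ℝ ∞ f {0}ᶜ)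
    (h2 : ∀ y, y ≠ 0 → 0 < fderiv ℝ (fderiv ℝ f) y (rot y) (rot y)) {u v : Plane}
    (hc : cross u v ≠ 0) : f (u + v) < f u + f v := by
  have hc' : cross u (v - u) ≠ 0 := by rwa [cross_sub_right, cross_self, sub_zero]
  have := (hf.strictConvexOn_line hs h2 hc').2 (mem_univ 0) (mem_univ 1) zero_ne_one
    (show (0 : ℝ) < 1 / 2 by norm_num) (show (0 : ℝ) < 1 / 2 by norm_num) (by norm_num)
  have e : u + ((1 / 2 : ℝ) • (0 : ℝ) + (1 / 2 : ℝ) • (1 : ℝ)) • (v - u) = (1 / 2 : ℝ) • (u + v) := by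
    simp only [smul_eq_mul, mul_zero, mul_one, zero_add]
    module
  simp only [e] at this
  simp only [zero_smul, add_zero, one_smul, add_sub_cancel, smul_eq_mul] at this
  rw [hf _ (by norm_num)] at this
  linarith

/-- A positive `1`-homogeneous function, smooth away from the origin, is a Minkowski norm if and
only if its transversal second derivative is positive. -/
theorem PosHomogeneous.isMinkowskiNorm_iff (hf : PosHomogeneous f)
    (hpos : ∀ y, y ≠ 0 → 0 < f y) (hs : ContDiffOn ℝ ∞ f {0}ᶜ) :
    IsMinkowskiNorm f ↔ ∀ y, y ≠ 0 → 0 < fderiv ℝ (fderiv ℝ f) y (rot y) (rot y) := by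
  constructor
  · exact fun h y hy => (hf.posDef_hessianSq_iff hpos hs hy).1 (h.posDef y hy)
  intro h2
  have hpar : ∀ u v : Plane, u ≠ 0 → cross u v = 0 →
      f (u + v) ≤ f u + f v ∧ (f (u + v) = f u + f v → ∃ a₁ a₂ : ℝ, 0 ≤ a₁ ∧ 0 ≤ a₂ ∧
        0 < a₁ + a₂ ∧ a₁ • u = a₂ • v) := by
    intro u v hu hc
    obtain ⟨t, rfl⟩ := exists_smul_of_cross_eq_zero hu hc
    rcases le_or_gt 0 t with ht | ht
    · refine ⟨?_, fun _ => ⟨t, 1, ht, zero_le_one, by linarith, by rw [one_smul]⟩⟩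
      have e : u + t • u = (1 + t) • u := by module
      rw [e, hf _ (by linarith)]
      rcases ht.eq_or_lt with rfl | ht
      · simp [hf.map_zero]
      · rw [hf _ ht]; linarith
    · have hlt : f (u + t • u) < f u + f (t • u) := by
        have h3 : 0 < f (t • u) := hpos _ (smul_ne_zero ht.ne hu)
        rcases lt_trichotomy (1 + t) 0 with h4 | h4 | h4
        · have e : u + t • u = ((1 + t) / t) • (t • u) := by
            rw [smul_smul, div_mul_cancel₀ _ ht.ne]; module
          rw [e, hf _ (div_pos_of_neg_of_neg h4 ht)]
          have : (1 + t) / t < 1 := by rw [div_lt_one_of_neg ht]; linarith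
          have h5 := hpos u hu
          nlinarith
        · have e : u + t • u = (1 + t) • u := by module
          rw [e, h4, zero_smul, hf.map_zero]
          have h5 := hpos u hu
          linarith
        · have e : u + t • u = (1 + t) • u := by module
          rw [e, hf _ h4]
          have h5 := hpos u hu
          nlinarith
      exact ⟨hlt.le, fun h => absurd h hlt.ne⟩
  refine ⟨⟨hpos, hf, ?_, ?_, hs⟩, fun y hy => (hf.posDef_hessianSq_iff hpos hs hy).2 (h2 y hy)⟩
  · intro u v
    by_cases hu : u = 0
    · subst hu; simp [hf.map_zero]
    by_cases hc : cross u v = 0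
    · exact (hpar u v hu hc).1
    · exact (hf.add_lt_of_cross_ne_zero hs h2 hc).le
  · intro u v huv
    by_cases hu : u = 0
    · subst hu; exact ⟨1, 0, zero_le_one, le_rfl, by norm_num, by simp⟩
    by_cases hc : cross u v = 0
    · exact (hpar u v hu hc).2 huv
    · exact absurd huv (hf.add_lt_of_cross_ne_zero hs h2 hc).ne

end Homogeneous

/-! ### The implicit equation `t = g (y + t x)` -/

/-- The properties of `g` that make the solution `t = Φ(x, y)` of `t = g (y + t x)` a smooth
function on `Ω × (ℝ² ∖ {0})`: unique solvability and nondegeneracy of the equation. -/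
structure FunkAdmissible (g : Plane → ℝ) (Ω : Set Plane) : Prop where
  homogeneous : PosHomogeneous g
  smooth : ContDiffOn ℝ ∞ g {0}ᶜ
  unique : ∀ x ∈ Ω, ∀ y, ∃! t : ℝ, t = g (y + t • x)
  fderiv_lt : ∀ x ∈ Ω, ∀ ξ, ξ ≠ 0 → fderiv ℝ g ξ x < 1

namespace FunkAdmissible

variable {g : Plane → ℝ} {Ω : Set Plane}

theorem spec (h : FunkAdmissible g Ω) {x : Plane} (hx : x ∈ Ω) (y : Plane) :
    funkSolution g x y = g (y + funkSolution g x y • x) :=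
  Classical.epsilon_spec (h.unique x hx y).exists

theorem eq_funkSolution (h : FunkAdmissible g Ω) {x : Plane} (hx : x ∈ Ω) {y : Plane} {t : ℝ}
    (ht : t = g (y + t • x)) : t = funkSolution g x y :=
  (h.unique x hx y).unique ht (h.spec hx y)

theorem funkSolution_smul (h : FunkAdmissible g Ω) {x : Plane} (hx : x ∈ Ω) {c : ℝ} (hc : 0 < c)
    (y : Plane) : funkSolution g x (c • y) = c * funkSolution g x y := by
  refine (h.eq_funkSolution hx ?_).symm
  nth_rw 1 [h.spec hx y]
  rw [← h.homogeneous c hc]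
  congr 1
  module

theorem posHomogeneous_funkSolution (h : FunkAdmissible g Ω) {x : Plane} (hx : x ∈ Ω) :
    PosHomogeneous (funkSolution g x) := fun _ hc y => h.funkSolution_smul hx hc y

theorem add_smul_ne_zero (h : FunkAdmissible g Ω) {x : Plane} (hx : x ∈ Ω) {y : Plane}
    (hy : y ≠ 0) : y + funkSolution g x y • x ≠ 0 := by
  intro h0
  have h1 := h.spec hx y
  rw [h0, h.homogeneous.map_zero] at h1
  rw [h1] at h0
  simp at h0
  exact hy h0

theorem contDiffOn_funkSolution (h : FunkAdmissible g Ω) (hΩ : IsOpen Ω) :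
    ContDiffOn ℝ ∞ (fun p : Plane × Plane => funkSolution g p.1 p.2) (Ω ×ˢ {0}ᶜ) := by
  rintro ⟨x, y⟩ ⟨hx, hy⟩
  apply ContDiffAt.contDiffWithinAt
  simp only at hx hy
  set t := funkSolution g x y with ht
  have hξ : y + t • x ≠ 0 := h.add_smul_ne_zero hx hy
  set f : (Plane × Plane) × ℝ → ℝ := fun u => u.2 - g (u.1.2 + u.2 • u.1.1) with hf
  have hg : ContDiffAt ℝ ∞ g (y + t • x) := h.smooth.contDiffAt (isOpen_compl_zero.mem_nhds hξ)
  have hfc : ContDiffAt ℝ ∞ f ((x, y), t) := by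
    refine contDiffAt_snd.sub (ContDiffAt.comp ((x, y), t)
      (f := fun u : (Plane × Plane) × ℝ => u.1.2 + u.2 • u.1.1) hg ?_)
    fun_prop
  have hcomp : ∀ s : ℝ, (fderiv ℝ f ((x, y), t) ∘L .inr ℝ (Plane × Plane) ℝ) s =
      (1 - fderiv ℝ g (y + t • x) x) * s := by
    intro s
    have h1 : HasFDerivAt (fun s : ℝ => f ((x, y), s))
        (fderiv ℝ f ((x, y), t) ∘L .inr ℝ (Plane × Plane) ℝ) t :=
      (hfc.differentiableAt (by simp)).hasFDerivAt.comp t (hasFDerivAt_prodMk_right (x, y) t)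
    have h2 : HasDerivAt (fun s : ℝ => f ((x, y), s)) (1 - fderiv ℝ g (y + t • x) x) t :=
      (hasDerivAt_id t).sub (hasDerivAt_line_of_smooth h.smooth y x hξ)
    rw [h1.unique h2.hasFDerivAt]
    simp [mul_comm]
  have hinv : (fderiv ℝ f ((x, y), t) ∘L .inr ℝ (Plane × Plane) ℝ).IsInvertible := by
    have hne : 1 - fderiv ℝ g (y + t • x) x ≠ 0 := by
      have := h.fderiv_lt x hx _ hξ
      linarith
    refine ⟨ContinuousLinearEquiv.unitsEquivAut ℝ (Units.mk0 _ hne), ?_⟩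
    ext
    rw [hcomp]
    simp
  have hcd := hfc.contDiffAt_implicitFunction (by simp) hinv
  have hev := hfc.eventually_apply_implicitFunction (by simp) hinv
  refine hcd.congr_of_eventuallyEq ?_
  have hΩ' : ∀ᶠ p : Plane × Plane in 𝓝 (x, y), p.1 ∈ Ω :=
    continuous_fst.continuousAt.eventually (hΩ.mem_nhds hx)
  filter_upwards [hev, hΩ'] with p hp hpΩ
  refine (h.eq_funkSolution hpΩ ?_).symm
  have h0 : f ((x, y), t) = 0 := by
    simp only [hf]
    rw [sub_eq_zero]
    exact h.spec hx y
  rw [h0] at hp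
  exact sub_eq_zero.1 hp

theorem isOpen_prod (hΩ : IsOpen Ω) : IsOpen (Ω ×ˢ ({0}ᶜ : Set Plane)) :=
  hΩ.prod isOpen_compl_zero

theorem hasFDerivAt_funkSolution (h : FunkAdmissible g Ω) (hΩ : IsOpen Ω) {p : Plane × Plane}
    (hp : p ∈ Ω ×ˢ ({0}ᶜ : Set Plane)) :
    HasFDerivAt (fun p : Plane × Plane => funkSolution g p.1 p.2)
      (fderiv ℝ (fun p : Plane × Plane => funkSolution g p.1 p.2) p) p :=
  (((h.contDiffOn_funkSolution hΩ).contDiffAt ((isOpen_prod hΩ).mem_nhds hp)).differentiableAt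
    (by simp)).hasFDerivAt

/-- The derivative of `k (y + x Φ(x, y))`. -/
theorem fderiv_comp (h : FunkAdmissible g Ω) (hΩ : IsOpen Ω) {k : Plane → ℝ}
    (hk : ContDiffOn ℝ ∞ k {0}ᶜ) {p : Plane × Plane} (hp : p ∈ Ω ×ˢ ({0}ᶜ : Set Plane))
    (u : Plane × Plane) :
    fderiv ℝ (fun p : Plane × Plane => k (p.2 + funkSolution g p.1 p.2 • p.1)) p u =
      fderiv ℝ k (p.2 + funkSolution g p.1 p.2 • p.1)
        (u.2 + funkSolution g p.1 p.2 • u.1 +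
          fderiv ℝ (fun p : Plane × Plane => funkSolution g p.1 p.2) p u • p.1) := by
  have h1 := h.hasFDerivAt_funkSolution hΩ hp
  have h2 : HasFDerivAt (fun p : Plane × Plane => p.2 + funkSolution g p.1 p.2 • p.1) _ p :=
    hasFDerivAt_snd.add (h1.smul hasFDerivAt_fst)
  have h3 : HasFDerivAt k _ (p.2 + funkSolution g p.1 p.2 • p.1) :=
    (differentiableAt_of_smooth hk (h.add_smul_ne_zero hp.1 hp.2)).hasFDerivAt
  have h4 : fderiv ℝ (fun p : Plane × Plane => k (p.2 + funkSolution g p.1 p.2 • p.1)) p = _ :=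
    (h3.comp p h2).fderiv
  rw [h4]
  simp [add_assoc]

/-- Implicit differentiation of `Φ = g (y + x Φ)`. -/
theorem fderiv_funkSolution_eq (h : FunkAdmissible g Ω) (hΩ : IsOpen Ω) {p : Plane × Plane}
    (hp : p ∈ Ω ×ˢ ({0}ᶜ : Set Plane)) (u : Plane × Plane) :
    fderiv ℝ (fun p : Plane × Plane => funkSolution g p.1 p.2) p u =
      fderiv ℝ g (p.2 + funkSolution g p.1 p.2 • p.1)
        (u.2 + funkSolution g p.1 p.2 • u.1 +
          fderiv ℝ (fun p : Plane × Plane => funkSolution g p.1 p.2) p u • p.1) := by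
  rw [← h.fderiv_comp hΩ h.smooth hp]
  have : (fun p : Plane × Plane => funkSolution g p.1 p.2) =ᶠ[𝓝 p]
      fun p : Plane × Plane => g (p.2 + funkSolution g p.1 p.2 • p.1) := by
    filter_upwards [(isOpen_prod hΩ).mem_nhds hp] with q hq using h.spec hq.1 q.2
  rw [this.fderiv_eq]

/-- The equation `Φ_x = Φ Φ_y`. -/
theorem dirDeriv_funkSolution (h : FunkAdmissible g Ω) (hΩ : IsOpen Ω) (w : Plane)
    {p : Plane × Plane} (hp : p ∈ Ω ×ˢ ({0}ᶜ : Set Plane)) :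
    dirDeriv (w, 0) (fun p : Plane × Plane => funkSolution g p.1 p.2) p =
      funkSolution g p.1 p.2 *
        dirDeriv (0, w) (fun p : Plane × Plane => funkSolution g p.1 p.2) p := by
  have h1 := h.fderiv_funkSolution_eq hΩ hp (w, 0)
  have h2 := h.fderiv_funkSolution_eq hΩ hp (0, w)
  have h3 := h.fderiv_lt p.1 hp.1 _ (h.add_smul_ne_zero hp.1 hp.2)
  simp only [dirDeriv]
  simp only [map_add, map_smul, smul_eq_mul, zero_add, add_zero, smul_zero] at h1 h2
  have h4 : 1 - fderiv ℝ g (p.2 + funkSolution g p.1 p.2 • p.1) p.1 ≠ 0 := by linarith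
  apply mul_left_cancel₀ h4
  linear_combination h1 - funkSolution g p.1 p.2 * h2

/-- The equation `k(ξ)_x = Φ k(ξ)_y` for functions of `ξ = y + x Φ(x, y)`. -/
theorem dirDeriv_comp (h : FunkAdmissible g Ω) (hΩ : IsOpen Ω) {k : Plane → ℝ}
    (hk : ContDiffOn ℝ ∞ k {0}ᶜ) (w : Plane) {p : Plane × Plane}
    (hp : p ∈ Ω ×ˢ ({0}ᶜ : Set Plane)) :
    dirDeriv (w, 0) (fun p : Plane × Plane => k (p.2 + funkSolution g p.1 p.2 • p.1)) p =
      funkSolution g p.1 p.2 *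
        dirDeriv (0, w) (fun p : Plane × Plane => k (p.2 + funkSolution g p.1 p.2 • p.1)) p := by
  have h1 := h.dirDeriv_funkSolution hΩ w hp
  simp only [dirDeriv, h.fderiv_comp hΩ hk hp] at h1 ⊢
  rw [h1]
  simp only [map_add, map_smul, smul_eq_mul, zero_add, add_zero, smul_zero]
  ring

theorem one_add_dirDeriv_pos (h : FunkAdmissible g Ω) (hΩ : IsOpen Ω) {p : Plane × Plane}
    (hp : p ∈ Ω ×ˢ ({0}ᶜ : Set Plane)) :
    0 < 1 + dirDeriv (0, p.1) (fun p : Plane × Plane => funkSolution g p.1 p.2) p := by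
  have h2 := h.fderiv_funkSolution_eq hΩ hp (0, p.1)
  have h3 := h.fderiv_lt p.1 hp.1 _ (h.add_smul_ne_zero hp.1 hp.2)
  simp only [map_add, map_smul, smul_eq_mul, add_zero, smul_zero] at h2
  simp only [dirDeriv]
  have h4 : 0 < 1 - fderiv ℝ g (p.2 + funkSolution g p.1 p.2 • p.1) p.1 := by linarith
  refine pos_of_mul_pos_left (b := 1 - fderiv ℝ g (p.2 + funkSolution g p.1 p.2 • p.1) p.1) ?_ h4.le
  have : (1 + fderiv ℝ (fun p : Plane × Plane => funkSolution g p.1 p.2) p (0, p.1)) *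
      (1 - fderiv ℝ g (p.2 + funkSolution g p.1 p.2 • p.1) p.1) = 1 := by
    linear_combination h2
  rw [this]
  exact one_pos

end FunkAdmissible

/-! ### Admissible functions -/

namespace IsWeakMinkowskiNorm

variable {g : Plane → ℝ}

theorem nonneg (hg : IsWeakMinkowskiNorm g) (y : Plane) : 0 ≤ g y := by
  by_cases hy : y = 0
  · rw [hy, hg.homogeneous.map_zero]
  · exact (hg.pos y hy).le

theorem map_smul (hg : IsWeakMinkowskiNorm g) {c : ℝ} (hc : 0 ≤ c) (y : Plane) :
    g (c • y) = c * g y := by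
  rcases hc.eq_or_lt with rfl | hc
  · simp [hg.homogeneous.map_zero]
  · exact hg.homogeneous c hc y

theorem convexOn (hg : IsWeakMinkowskiNorm g) : ConvexOn ℝ univ g :=
  ⟨convex_univ, fun x _ y _ a b ha hb _ => by
    rw [smul_eq_mul, smul_eq_mul, ← hg.map_smul ha, ← hg.map_smul hb]
    exact hg.subadditive _ _⟩

theorem continuous (hg : IsWeakMinkowskiNorm g) : Continuous g :=
  continuousOn_univ.1 (hg.convexOn.continuousOn isOpen_univ)

theorem isOpen_sublevel (hg : IsWeakMinkowskiNorm g) : IsOpen {x | g x < 1} :=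
  isOpen_lt hg.continuous continuous_const

theorem convex_sublevel (hg : IsWeakMinkowskiNorm g) : Convex ℝ {x | g x < 1} := by
  simpa using hg.convexOn.convex_lt 1

theorem fderiv_le (hg : IsWeakMinkowskiNorm g) {ξ : Plane} (hξ : ξ ≠ 0) (x : Plane) :
    fderiv ℝ g ξ x ≤ g x := by
  have h1 := hasDerivAt_line_of_smooth hg.smooth ξ x (t := 0) (by simpa using hξ)
  simp only [zero_smul, add_zero] at h1
  refine le_of_tendsto h1.tendsto_slope_zero_right ?_
  filter_upwards [self_mem_nhdsWithin] with t ht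
  have ht' : (0 : ℝ) < t := ht
  have h2 := hg.subadditive ξ (t • x)
  rw [hg.homogeneous t ht'] at h2
  simp only [zero_add, zero_smul, add_zero, smul_eq_mul]
  rw [inv_mul_le_iff₀ ht']
  linarith

theorem funkAdmissible (hg : IsWeakMinkowskiNorm g) : FunkAdmissible g {x | g x < 1} where
  homogeneous := hg.homogeneous
  smooth := hg.smooth
  unique := by
    intro x hx y
    have hx : g x < 1 := hx
    have hcont : Continuous fun t : ℝ => t - g (y + t • x) := by
      have := hg.continuous
      fun_prop
    have hmono : ∀ s t : ℝ, s < t → s - g (y + s • x) < t - g (y + t • x) := by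
      intro s t hst
      have h1 := hg.subadditive (y + s • x) ((t - s) • x)
      rw [hg.homogeneous _ (sub_pos.2 hst)] at h1
      have e : y + s • x + (t - s) • x = y + t • x := by module
      rw [e] at h1
      nlinarith
    have hex : ∃ t : ℝ, t - g (y + t • x) = 0 := by
      have h1 : 0 < 1 - g x := by linarith
      set T := g y / (1 - g x) with hT
      have hT0 : 0 ≤ T := div_nonneg (hg.nonneg y) h1.le
      have h2 := hg.subadditive y (T • x)
      rw [hg.map_smul hT0] at h2
      have h3 : T * (1 - g x) = g y := div_mul_cancel₀ _ h1.ne'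
      have h4 : 0 ≤ T - g (y + T • x) := by linarith
      have h5 : (0 : ℝ) - g (y + (0 : ℝ) • x) ≤ 0 := by
        have := hg.nonneg (y + (0 : ℝ) • x)
        linarith
      obtain ⟨t, -, ht⟩ := intermediate_value_Icc hT0 hcont.continuousOn ⟨h5, h4⟩
      exact ⟨t, ht⟩
    obtain ⟨t, ht⟩ := hex
    refine ⟨t, sub_eq_zero.1 ht, fun s hs => ?_⟩
    have hs' : s - g (y + s • x) = 0 := sub_eq_zero.2 hs
    rcases lt_trichotomy s t with h | h | h
    · exact absurd (hmono _ _ h) (by rw [ht, hs']; exact lt_irrefl _)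
    · exact h
    · exact absurd (hmono _ _ h) (by rw [ht, hs']; exact lt_irrefl _)
  fderiv_lt := fun x hx _ hξ => (hg.fderiv_le hξ x).trans_lt hx

end IsWeakMinkowskiNorm

/-- If `t ↦ t - g (y + t x)` has a zero at which it decreases, then it has another one: for large
`t` of one of the signs, its sign is that of `t`, as `g` does not change sign. -/
theorem fderiv_le_one_of_unique {g : Plane → ℝ} (hc : Continuous g)
    (hs : ContDiffOn ℝ ∞ g {0}ᶜ) (hsign : (∀ y, 0 ≤ g y) ∨ (∀ y, g y ≤ 0)) {x : Plane}
    (hu : ∀ y, ∃! t : ℝ, t = g (y + t • x)) {ξ : Plane} (hξ : ξ ≠ 0) : fderiv ℝ g ξ x ≤ 1 := by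
  by_contra! h
  set y := ξ - g ξ • x with hy
  have e : y + g ξ • x = ξ := by rw [hy]; module
  have hcont : Continuous fun t : ℝ => t - g (y + t • x) := by fun_prop
  have hd : HasDerivAt (fun t : ℝ => t - g (y + t • x)) (1 - fderiv ℝ g ξ x) (g ξ) := by
    have := hasDerivAt_line_of_smooth hs y x (t := g ξ) (by rw [e]; exact hξ)
    rw [e] at this
    exact (hasDerivAt_id (g ξ)).sub this
  have hzero : ∀ t : ℝ, t - g (y + t • x) = 0 → t = g ξ := fun t ht =>
    (hu y).unique (sub_eq_zero.1 ht) (by rw [e])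
  have hneg : 1 - fderiv ℝ g ξ x < 0 := by linarith
  rcases hsign with hp | hn
  · have h1 := (hd.tendsto_slope_zero_left.eventually (gt_mem_nhds hneg)).and self_mem_nhdsWithin
    obtain ⟨r, hr, hr0⟩ := h1.exists
    have hr0 : r < 0 := hr0
    simp only [e, sub_self, sub_zero, smul_eq_mul] at hr
    have h2 : 0 < (g ξ + r) - g (y + (g ξ + r) • x) :=
      pos_of_mul_neg_right hr (inv_nonpos.2 hr0.le)
    set T := min (g ξ + r) (-1) with hT
    have h3 : T - g (y + T • x) ≤ 0 := by
      have := hp (y + T • x)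
      have : T ≤ -1 := min_le_right _ _
      linarith
    obtain ⟨t, ⟨-, ht2⟩, ht⟩ := intermediate_value_Icc (min_le_left _ _ : T ≤ g ξ + r)
      hcont.continuousOn ⟨h3, h2.le⟩
    have := hzero t ht
    linarith
  · have h1 := (hd.tendsto_slope_zero_right.eventually (gt_mem_nhds hneg)).and self_mem_nhdsWithin
    obtain ⟨r, hr, hr0⟩ := h1.exists
    have hr0 : 0 < r := hr0
    simp only [e, sub_self, sub_zero, smul_eq_mul] at hr
    have h2 : (g ξ + r) - g (y + (g ξ + r) • x) < 0 :=
      neg_of_mul_neg_right hr (inv_nonneg.2 hr0.le)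
    set T := max (g ξ + r) 1 with hT
    have h3 : 0 ≤ T - g (y + T • x) := by
      have := hn (y + T • x)
      have : 1 ≤ T := le_max_right _ _
      linarith
    obtain ⟨t, ⟨ht1, -⟩, ht⟩ := intermediate_value_Icc (le_max_left _ _ : g ξ + r ≤ T)
      hcont.continuousOn ⟨h2.le, h3⟩
    have := hzero t ht
    linarith

/-- A function of constant sign for which the equation `t = g (y + t x)` is uniquely solvable for
all `x` in an open set is admissible: if `dg(x) = 1` at some point, then `dg(cx) > 1` for `c > 1`
close to `1`. -/
theorem funkAdmissible_of_unique {g : Plane → ℝ} {Ω : Set Plane} (hΩ : IsOpen Ω)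
    (hc : Continuous g) (hg : PosHomogeneous g) (hs : ContDiffOn ℝ ∞ g {0}ᶜ)
    (hsign : (∀ y, 0 ≤ g y) ∨ (∀ y, g y ≤ 0))
    (hu : ∀ x ∈ Ω, ∀ y, ∃! t : ℝ, t = g (y + t • x)) : FunkAdmissible g Ω := by
  refine ⟨hg, hs, hu, fun x hx ξ hξ => ?_⟩
  by_contra! h
  have hcont : Continuous fun c : ℝ => c • x := by fun_prop
  have h1 : ∀ᶠ c : ℝ in 𝓝[>] 1, c • x ∈ Ω := by
    have := hcont.tendsto 1
    rw [one_smul] at this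
    exact (this.mono_left nhdsWithin_le_nhds).eventually (hΩ.mem_nhds hx)
  obtain ⟨c, hcΩ, hc1⟩ := (h1.and self_mem_nhdsWithin).exists
  have hc1 : 1 < c := hc1
  have h2 := fderiv_le_one_of_unique hc hs hsign (hu _ hcΩ) hξ
  rw [map_smul, smul_eq_mul] at h2
  nlinarith

/-! ### Invariance of the transversal second derivative along lines -/

theorem dirDeriv_smul_snd {S : Set (Plane × Plane)} (hS : IsOpen S) {f : Plane × Plane → ℝ}
    (hf : ContDiffOn ℝ ∞ f S) {a c : ℝ} (hcS : ∀ p ∈ S, (p.1, c • p.2) ∈ S)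
    (h : ∀ p ∈ S, f (p.1, c • p.2) = a * f p) (v : Plane) {p : Plane × Plane} (hp : p ∈ S) :
    c * dirDeriv (0, v) f (p.1, c • p.2) = a * dirDeriv (0, v) f p := by
  have hd : ∀ q ∈ S, HasFDerivAt f (fderiv ℝ f q) q := fun q hq =>
    ((hf.contDiffAt (hS.mem_nhds hq)).differentiableAt (by simp)).hasFDerivAt
  have h1 : HasFDerivAt (fun q : Plane × Plane => (q.1, c • q.2)) _ p :=
    HasFDerivAt.prodMk hasFDerivAt_fst
      (HasFDerivAt.const_smul (hasFDerivAt_snd (𝕜 := ℝ) (E := Plane) (F := Plane) (p := p)) c)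
  have h2 : HasFDerivAt (fun q : Plane × Plane => f (q.1, c • q.2)) _ p :=
    HasFDerivAt.comp p (hd _ (hcS p hp)) h1
  have h3 : HasFDerivAt (fun q => a * f q) _ p := (hd p hp).const_mul a
  have h4 : (fun q : Plane × Plane => f (q.1, c • q.2)) =ᶠ[𝓝 p] fun q => a * f q := by
    filter_upwards [hS.mem_nhds hp] with q hq using h q hq
  have h5 := congrArg (fun L : Plane × Plane →L[ℝ] ℝ => L (0, v))
    (h2.unique (h3.congr_of_eventuallyEq h4))
  have e : ((0 : Plane), c • v) = c • ((0 : Plane), v) := by simp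
  simp only [ContinuousLinearMap.comp_apply, ContinuousLinearMap.prod_apply, smul_apply,
    ContinuousLinearMap.coe_fst', ContinuousLinearMap.coe_snd', smul_eq_mul] at h5
  rw [e, map_smul, smul_eq_mul] at h5
  exact h5

/-- The mixed derivatives of `F` and `Q`, if `F_x = Q_y`. The second `y`-derivatives of the
`2`-homogeneous function `Q` are `0`-homogeneous, so their radial derivative is zero. -/
theorem dirDeriv_dirDeriv_dirDeriv_eq_zero {S : Set (Plane × Plane)} (hS : IsOpen S)
    (hcS : ∀ c : ℝ, 0 < c → ∀ p ∈ S, (p.1, c • p.2) ∈ S) {F Q : Plane × Plane → ℝ}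
    (hF : ContDiffOn ℝ ∞ F S) (hQ : ContDiffOn ℝ ∞ Q S)
    (hQh : ∀ c : ℝ, 0 < c → ∀ p ∈ S, Q (p.1, c • p.2) = c ^ 2 * Q p)
    (hFQ : ∀ w : Plane, EqOn (dirDeriv (w, 0) F) (dirDeriv (0, w) Q) S) (v : Plane)
    {p : Plane × Plane} (hp : p ∈ S) :
    dirDeriv (p.2, 0) (dirDeriv (0, v) (dirDeriv (0, v) F)) p = 0 := by
  set w := p.2 with hw
  have hF1 := contDiffOn_dirDeriv hS hF (0, v)
  have hQ1 := contDiffOn_dirDeriv hS hQ (0, v)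
  have hQ2 := contDiffOn_dirDeriv hS hQ1 (0, v)
  have e1 : EqOn (dirDeriv (w, 0) (dirDeriv (0, v) (dirDeriv (0, v) F)))
      (dirDeriv (0, w) (dirDeriv (0, v) (dirDeriv (0, v) Q))) S := by
    have c1 := dirDeriv_comm hS hF1 (w, 0) (0, v)
    have c2 := dirDeriv_congr hS (dirDeriv_comm hS hF (w, 0) (0, v)) (0, v)
    have c3 := dirDeriv_congr hS (dirDeriv_congr hS (hFQ w) (0, v)) (0, v)
    have c4 := dirDeriv_congr hS (dirDeriv_comm hS hQ (0, v) (0, w)) (0, v)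
    have c5 := dirDeriv_comm hS hQ1 (0, v) (0, w)
    exact c1.trans (c2.trans (c3.trans (c4.trans c5)))
  rw [e1 hp]
  set R := dirDeriv (0, v) (dirDeriv (0, v) Q) with hR
  have hRh : ∀ c : ℝ, 0 < c → R (p.1, c • w) = R p := by
    intro c hc
    have d1 : ∀ q ∈ S, dirDeriv (0, v) Q (q.1, c • q.2) = c * dirDeriv (0, v) Q q := by
      intro q hq
      have := dirDeriv_smul_snd hS hQ (hcS c hc) (hQh c hc) v hq
      have h2 : c * dirDeriv (0, v) Q (q.1, c • q.2) = c * (c * dirDeriv (0, v) Q q) := by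
        rw [this]; ring
      exact mul_left_cancel₀ hc.ne' h2
    exact mul_left_cancel₀ hc.ne' (dirDeriv_smul_snd hS hQ1 (hcS c hc) d1 v hp)
  have hd : HasFDerivAt R (fderiv ℝ R p) (p.1, w + (0 : ℝ) • w) := by
    rw [zero_smul, add_zero]
    exact ((hQ2.contDiffAt (hS.mem_nhds hp)).differentiableAt (by simp)).hasFDerivAt
  have h1 : HasDerivAt (fun t : ℝ => (p.1, w + t • w)) ((0 : Plane), w) 0 := by
    refine (hasDerivAt_const _ _).prodMk ?_
    simpa using ((hasDerivAt_id (0 : ℝ)).smul_const w).const_add w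
  have h2 := hd.comp_hasDerivAt (0 : ℝ) h1
  have h3 : (R ∘ fun t : ℝ => (p.1, w + t • w)) =ᶠ[𝓝 0] fun _ => R p := by
    filter_upwards [lt_mem_nhds (show (-1 : ℝ) < 0 by norm_num)] with t ht
    have := hRh (1 + t) (by linarith)
    rw [add_smul, one_smul] at this
    exact this
  exact h2.unique ((hasDerivAt_const (0 : ℝ) (R p)).congr_of_eventuallyEq h3)

/-- A Finsler function `F` on the convex open set `Ω` satisfying Hamel's equation of projective
flatness in the form `F_x = Q_y` with a positively `2`-homogeneous `Q`. -/
structure ProjectivelyFlat (Ω : Set Plane) (F Q : Plane → Plane → ℝ) : Prop where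
  isOpen : IsOpen Ω
  convex : Convex ℝ Ω
  homogeneous : ∀ x ∈ Ω, PosHomogeneous (F x)
  pos : ∀ x ∈ Ω, ∀ y, y ≠ 0 → 0 < F x y
  smooth : ContDiffOn ℝ ∞ (fun p : Plane × Plane => F p.1 p.2) (Ω ×ˢ {0}ᶜ)
  smooth_potential : ContDiffOn ℝ ∞ (fun p : Plane × Plane => Q p.1 p.2) (Ω ×ˢ {0}ᶜ)
  homogeneous_potential : ∀ c : ℝ, 0 < c → ∀ x ∈ Ω, ∀ y, y ≠ 0 → Q x (c • y) = c ^ 2 * Q x y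
  hamel : ∀ w : Plane, EqOn (dirDeriv (w, 0) fun p : Plane × Plane => F p.1 p.2)
    (dirDeriv (0, w) fun p : Plane × Plane => Q p.1 p.2) (Ω ×ˢ {0}ᶜ)

namespace ProjectivelyFlat

variable {Ω : Set Plane} {F Q : Plane → Plane → ℝ}

theorem isOpen_prod (h : ProjectivelyFlat Ω F Q) : IsOpen (Ω ×ˢ ({0}ᶜ : Set Plane)) :=
  h.isOpen.prod isOpen_compl_zero

theorem contDiffOn_apply (h : ProjectivelyFlat Ω F Q) {x : Plane} (hx : x ∈ Ω) :
    ContDiffOn ℝ ∞ (F x) {0}ᶜ :=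
  h.smooth.comp (f := fun y : Plane => (x, y)) (by fun_prop) fun _ hy => ⟨hx, hy⟩

/-- The second derivative of `F(x, ·)` at `y` in the transversal direction `rot y`. It decides on
the definiteness of the Hessian of `F(x, ·)²` at `y`. -/
noncomputable def transversal (F : Plane → Plane → ℝ) (x y : Plane) : ℝ :=
  fderiv ℝ (fderiv ℝ (F x)) y (rot y) (rot y)

theorem fderiv_fderiv_apply (h : ProjectivelyFlat Ω F Q) {x y : Plane} (hx : x ∈ Ω) (hy : y ≠ 0)
    (v : Plane) : fderiv ℝ (fderiv ℝ (F x)) y v v =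
      dirDeriv (0, v) (dirDeriv (0, v) fun p : Plane × Plane => F p.1 p.2) (x, y) := by
  have slice : ∀ G : Plane × Plane → ℝ, ContDiffOn ℝ ∞ G (Ω ×ˢ {0}ᶜ) → ∀ z, z ≠ 0 →
      dirDeriv v (fun z => G (x, z)) z = dirDeriv (0, v) G (x, z) := by
    intro G hG z hz
    have hd : HasFDerivAt G (fderiv ℝ G (x, z)) (x, z) :=
      ((hG.contDiffAt (h.isOpen_prod.mem_nhds (mk_mem_prod hx hz))).differentiableAt (by simp)).hasFDerivAt
    have h1 : HasFDerivAt (fun z => G (x, z)) _ z := hd.comp z (hasFDerivAt_prodMk_right x z)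
    simp only [dirDeriv]
    rw [h1.fderiv]
    simp
  rw [← dirDeriv_dirDeriv_eq isOpen_compl_zero (h.contDiffOn_apply hx) v v hy]
  rw [dirDeriv_congr isOpen_compl_zero (fun z hz => slice _ h.smooth z hz) v hy]
  exact slice _ (contDiffOn_dirDeriv h.isOpen_prod h.smooth _) y hy

/-- The second derivatives of `F(x, ·)` at `y` do not change as `x` moves in the direction `y`. -/
theorem transversal_add_smul (h : ProjectivelyFlat Ω F Q) {x y : Plane} (hx : x ∈ Ω) (hy : y ≠ 0)
    {s : ℝ} (hs : x + s • y ∈ Ω) : transversal F (x + s • y) y = transversal F x y := by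
  unfold transversal
  rw [h.fderiv_fderiv_apply hs hy, h.fderiv_fderiv_apply hx hy]
  set M := dirDeriv (0, rot y) (dirDeriv (0, rot y) fun p : Plane × Plane => F p.1 p.2) with hM
  have hMs : ContDiffOn ℝ ∞ M (Ω ×ˢ {0}ᶜ) :=
    contDiffOn_dirDeriv h.isOpen_prod (contDiffOn_dirDeriv h.isOpen_prod h.smooth _) _
  have hline : Continuous fun t : ℝ => x + t • y := by fun_prop
  have hderiv : ∀ t : ℝ, x + t • y ∈ Ω → HasDerivAt (fun t : ℝ => M (x + t • y, y)) 0 t := by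
    intro t ht
    have hp : ((x + t • y, y) : Plane × Plane) ∈ Ω ×ˢ ({0}ᶜ : Set Plane) := ⟨ht, hy⟩
    have hd : HasFDerivAt M (fderiv ℝ M (x + t • y, y)) (x + t • y, y) :=
      ((hMs.contDiffAt (h.isOpen_prod.mem_nhds hp)).differentiableAt (by simp)).hasFDerivAt
    have h1 : HasDerivAt (fun t : ℝ => (x + t • y, y)) (y, (0 : Plane)) t := by
      refine HasDerivAt.prodMk ?_ (hasDerivAt_const _ _)
      simpa using ((hasDerivAt_id t).smul_const y).const_add x
    have h2 := hd.comp_hasDerivAt t h1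
    have h3 := dirDeriv_dirDeriv_dirDeriv_eq_zero h.isOpen_prod
      (fun c hc p hp => ⟨hp.1, smul_ne_zero hc.ne' hp.2⟩) h.smooth h.smooth_potential
      (fun c hc p hp => h.homogeneous_potential c hc p.1 hp.1 p.2 hp.2) h.hamel (rot y) hp
    have h4 : fderiv ℝ M (x + t • y, y) (y, 0) = 0 := h3
    rw [h4] at h2
    exact h2
  have hopen : IsOpen {t : ℝ | x + t • y ∈ Ω} := h.isOpen.preimage hline
  have hconv : Convex ℝ {t : ℝ | x + t • y ∈ Ω} := by
    intro a ha b hb p q hp hq hpq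
    have := h.convex ha hb hp hq hpq
    have e : p • (x + a • y) + q • (x + b • y) = x + (p • a + q • b) • y := by
      have : p = 1 - q := by linarith
      subst this
      simp only [smul_eq_mul]
      module
    rw [e] at this
    exact this
  have := hopen.is_const_of_deriv_eq_zero hconv.isPreconnected
    (f := fun t : ℝ => M (x + t • y, y))
    (fun t ht => (hderiv t ht).differentiableAt.differentiableWithinAt)
    (fun t ht => (hderiv t ht).deriv) (x := s) (y := 0) hs (by simpa using hx)
  simpa using this

theorem continuousOn_transversal (h : ProjectivelyFlat Ω F Q) :
    ContinuousOn (fun p : Plane × Plane => transversal F p.1 p.2) (Ω ×ˢ {0}ᶜ) := by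
  have h1 : ContinuousOn (fun p : Plane × Plane =>
      fderiv ℝ (fderiv ℝ fun p : Plane × Plane => F p.1 p.2) p (0, rot p.2) (0, rot p.2))
      (Ω ×ˢ {0}ᶜ) := by
    have h2 : ContDiffOn ℝ ∞ (fderiv ℝ (fderiv ℝ fun p : Plane × Plane => F p.1 p.2))
        (Ω ×ˢ {0}ᶜ) :=
      (h.smooth.fderiv_of_isOpen h.isOpen_prod (m := ∞) (by simp)).fderiv_of_isOpen
        h.isOpen_prod (by simp)
    have h3 : Continuous fun p : Plane × Plane => ((0 : Plane), rot p.2) := by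
      unfold rot; fun_prop
    exact (h2.continuousOn.clm_apply h3.continuousOn).clm_apply h3.continuousOn
  refine h1.congr fun p hp => ?_
  simp only [transversal]
  rw [h.fderiv_fderiv_apply hp.1 hp.2, dirDeriv_dirDeriv_eq h.isOpen_prod h.smooth _ _ hp]

theorem mem_minkowskiLocus_iff (h : ProjectivelyFlat Ω F Q) {x : Plane} :
    x ∈ minkowskiLocus Ω F ↔ x ∈ Ω ∧ ∀ y, y ≠ 0 → 0 < transversal F x y :=
  and_congr_right fun hx =>
    (h.homogeneous x hx).isMinkowskiNorm_iff (h.pos x hx) (h.contDiffOn_apply hx)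

theorem transversal_smul_pos (h : ProjectivelyFlat Ω F Q) {x y : Plane} (hx : x ∈ Ω) (hy : y ≠ 0)
    {c : ℝ} (hc : 0 < c) (hpos : 0 < transversal F x (c • y)) : 0 < transversal F x y := by
  have h1 : ∀ v, fderiv ℝ (fderiv ℝ (F x)) (c • y) v v * c =
      fderiv ℝ (fderiv ℝ (F x)) y v v := by
    intro v
    have hS : ∀ p ∈ Ω ×ˢ ({0}ᶜ : Set Plane), (p.1, c • p.2) ∈ Ω ×ˢ ({0}ᶜ : Set Plane) :=
      fun p hp => ⟨hp.1, smul_ne_zero hc.ne' hp.2⟩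
    rw [h.fderiv_fderiv_apply hx hy, h.fderiv_fderiv_apply hx (smul_ne_zero hc.ne' hy)]
    have d1 : ∀ q ∈ Ω ×ˢ ({0}ᶜ : Set Plane),
        dirDeriv (0, v) (fun p : Plane × Plane => F p.1 p.2) (q.1, c • q.2) =
          1 * dirDeriv (0, v) (fun p : Plane × Plane => F p.1 p.2) q := by
      intro q hq
      have := dirDeriv_smul_snd h.isOpen_prod h.smooth hS
        (fun p hp => h.homogeneous p.1 hp.1 c hc p.2) v hq
      rw [one_mul]
      exact mul_left_cancel₀ hc.ne' this
    have := dirDeriv_smul_snd h.isOpen_prod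
      (contDiffOn_dirDeriv h.isOpen_prod h.smooth (0, v)) hS d1 v
      (show ((x, y) : Plane × Plane) ∈ Ω ×ˢ ({0}ᶜ : Set Plane) from ⟨hx, hy⟩)
    rw [one_mul] at this
    rw [mul_comm]
    exact this
  have e : rot (c • y) = c • rot y := by
    apply plane_ext <;> simp [rot]
  unfold transversal at hpos ⊢
  rw [e] at hpos
  simp only [map_smul, smul_apply, smul_eq_mul] at hpos
  rw [← h1]
  have : 0 < fderiv ℝ (fderiv ℝ (F x)) (c • y) (rot y) (rot y) :=
    pos_of_mul_pos_right (pos_of_mul_pos_right hpos hc.le) hc.le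
  positivity

theorem isOpen_minkowskiLocus (h : ProjectivelyFlat Ω F Q) : IsOpen (minkowskiLocus Ω F) := by
  rw [isOpen_iff_mem_nhds]
  intro x₀ hx₀
  rw [h.mem_minkowskiLocus_iff] at hx₀
  have hK : IsCompact (Metric.sphere (0 : Plane) 1) := isCompact_sphere 0 1
  have hne : ∀ y ∈ Metric.sphere (0 : Plane) 1, y ≠ 0 := fun y hy =>
    ne_zero_of_mem_unit_sphere (⟨y, hy⟩ : Metric.sphere (0 : Plane) 1)
  have hev : ∀ᶠ x in 𝓝 x₀, ∀ y ∈ Metric.sphere (0 : Plane) 1, 0 < transversal F x y := by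
    apply hK.eventually_forall_of_forall_eventually
    intro y hy
    have hmem : (x₀, y) ∈ Ω ×ˢ ({0}ᶜ : Set Plane) := ⟨hx₀.1, hne y hy⟩
    exact (h.continuousOn_transversal.continuousAt (h.isOpen_prod.mem_nhds hmem)).eventually
      (lt_mem_nhds (hx₀.2 y (hne y hy)))
  filter_upwards [hev, h.isOpen.mem_nhds hx₀.1] with x hx hxΩ
  rw [h.mem_minkowskiLocus_iff]
  refine ⟨hxΩ, fun y hy => ?_⟩
  have hn : 0 < ‖y‖ := norm_pos_iff.2 hy
  refine h.transversal_smul_pos hxΩ hy (inv_pos.2 hn) (hx _ ?_)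
  simp [norm_smul, hn.ne']

/-- A line on which the transversal second derivative in its own direction is not positive misses
the set where `F` is a Minkowski norm. -/
theorem add_smul_notMem_minkowskiLocus (h : ProjectivelyFlat Ω F Q) {x y : Plane} (hx : x ∈ Ω)
    (hy : y ≠ 0) (hle : transversal F x y ≤ 0) (t : ℝ) : x + t • y ∉ minkowskiLocus Ω F := by
  intro hmem
  rw [h.mem_minkowskiLocus_iff] at hmem
  have h1 := hmem.2 y hy
  rw [h.transversal_add_smul hx hy hmem.1] at h1
  linarith

theorem exists_line (h : ProjectivelyFlat Ω F Q) {x : Plane} (hx : x ∈ Ω)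
    (hxO : x ∉ minkowskiLocus Ω F) :
    ∃ y, y ≠ 0 ∧ ∀ t : ℝ, x + t • y ∉ minkowskiLocus Ω F := by
  rw [h.mem_minkowskiLocus_iff] at hxO
  push Not at hxO
  obtain ⟨y, hy, hle⟩ := hxO hx
  exact ⟨y, hy, h.add_smul_notMem_minkowskiLocus hx hy hle⟩

theorem det_eq_zero_iff (h : ProjectivelyFlat Ω F Q) {x y : Plane} (hx : x ∈ Ω) (hy : y ≠ 0) :
    (hessianSq (F x) y).det = 0 ↔ transversal F x y = 0 :=
  (h.homogeneous x hx).det_hessianSq_eq_zero_iff (h.pos x hx) (h.contDiffOn_apply hx) hy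

/-- At a boundary point in `Ω` of the set where `F` is a Minkowski norm, some Hessian
degenerates: by continuity it is semidefinite, and it is not definite for all directions. -/
theorem exists_det_eq_zero (h : ProjectivelyFlat Ω F Q) {x : Plane}
    (hx : x ∈ frontier (minkowskiLocus Ω F)) (hxΩ : x ∈ Ω) :
    ∃ y, y ≠ 0 ∧ (hessianSq (F x) y).det = 0 := by
  rw [h.isOpen_minkowskiLocus.frontier_eq] at hx
  have hxO := hx.2
  rw [h.mem_minkowskiLocus_iff] at hxO
  push Not at hxO
  obtain ⟨y, hy, hle⟩ := hxO hxΩ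
  refine ⟨y, hy, (h.det_eq_zero_iff hxΩ hy).2 (le_antisymm hle ?_)⟩
  by_contra! hlt
  have hcont : ContinuousAt (fun z : Plane => transversal F z y) x :=
    (h.continuousOn_transversal.continuousAt (h.isOpen_prod.mem_nhds (mk_mem_prod hxΩ hy))).comp
      (f := fun z : Plane => (z, y)) (by fun_prop)
  obtain ⟨z, hz1, hz2⟩ :=
    mem_closure_iff_nhds.1 hx.1 _ (hcont.eventually (gt_mem_nhds hlt))
  have := (h.mem_minkowskiLocus_iff.1 hz2).2 y hy
  have hz1 : transversal F z y < 0 := hz1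
  linarith

/-- The structure of the set where a projectively flat `F` is a Minkowski norm. -/
theorem minkowskiLocus_structure (h : ProjectivelyFlat Ω F Q) {O : Set Plane}
    (hO : O = minkowskiLocus Ω F) :
    (∀ U, IsComponent O U → IsOpen U ∧ Convex ℝ U) ∧
    (∀ᵐ x ∂(μH[1] : Measure Plane), x ∈ frontier O ∩ Ω →
      ∀ y, y ≠ 0 → (hessianSq (F x) y).det = 0 → IsTangentToBoundary O x y) ∧
    ((frontier O ∩ Ω).Nonempty →
      ∃ x ∈ frontier O ∩ Ω, ∃ y, y ≠ 0 ∧ (hessianSq (F x) y).det = 0 ∧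
        IsTangentToBoundary O x y ∧ ∃ U, IsComponent O U ∧ x ∈ frontier U) := by
  subst hO
  have hopen := h.isOpen_minkowskiLocus
  have hsub : minkowskiLocus Ω F ⊆ Ω := fun x hx => hx.1
  have hline : ∀ x ∈ Ω, x ∉ minkowskiLocus Ω F →
      ∃ y, y ≠ 0 ∧ ∀ t : ℝ, x + t • y ∉ minkowskiLocus Ω F := fun x hx => h.exists_line hx
  have htan : ∀ x, x ∈ frontier (minkowskiLocus Ω F) ∩ Ω →
      x ∉ componentCorners (minkowskiLocus Ω F) → ∀ y, y ≠ 0 → (hessianSq (F x) y).det = 0 →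
      IsTangentToBoundary (minkowskiLocus Ω F) x y := by
    intro x hx hxc y hy hdet
    exact isTangentToBoundary_of_notMem_componentCorners h.convex hopen hsub hline hxc hy
      (h.add_smul_notMem_minkowskiLocus hx.2 hy ((h.det_eq_zero_iff hx.2 hy).1 hdet).le)
  refine ⟨fun U hU => ⟨hU.isOpen hopen, hU.convex h.convex hsub hline⟩, ?_, fun hne => ?_⟩
  · have := Measure.nullSingletonClass_hausdorff Plane (d := 1) one_pos
    have hnull : (μH[1] : Measure Plane) (componentCorners (minkowskiLocus Ω F)) = 0 :=
      (countable_componentCorners hopen).measure_zero _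
    filter_upwards [measure_eq_zero_iff_ae_notMem.1 hnull] with x hxc hx y hy hdet
    exact htan x hx hxc y hy hdet
  · obtain ⟨x, hx, hxc, hU⟩ := exists_mem_frontier_component h.convex h.isOpen hopen hsub hline hne
    obtain ⟨y, hy, hdet⟩ := h.exists_det_eq_zero hx.1 hx.2
    exact ⟨x, hx, y, hy, hdet, htan x hx hxc y hy hdet, hU⟩

end ProjectivelyFlat

/-! ### The two constructions -/

theorem FunkAdmissible.contDiffOn_comp {g k : Plane → ℝ} {Ω : Set Plane} (h : FunkAdmissible g Ω)
    (hΩ : IsOpen Ω) (hk : ContDiffOn ℝ ∞ k {0}ᶜ) :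
    ContDiffOn ℝ ∞ (fun p : Plane × Plane => k (p.2 + funkSolution g p.1 p.2 • p.1))
      (Ω ×ˢ {0}ᶜ) := by
  refine hk.comp (f := fun p : Plane × Plane => p.2 + funkSolution g p.1 p.2 • p.1) ?_
    fun p hp => h.add_smul_ne_zero hp.1 hp.2
  exact contDiffOn_snd.add ((h.contDiffOn_funkSolution hΩ).smul contDiffOn_fst)

/-- If `P_x = P P_y`, then `B = 1 + xᵏ P_{yᵏ}` satisfies `B_x = (P B)_y`. -/
theorem dirDeriv_one_add {S : Set (Plane × Plane)} (hS : IsOpen S) {P : Plane × Plane → ℝ}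
    (hP : ContDiffOn ℝ ∞ P S) {w : Plane}
    (hPDE : EqOn (dirDeriv (w, 0) P) (fun q => P q * dirDeriv (0, w) P q) S)
    {p : Plane × Plane} (hp : p ∈ S) :
    dirDeriv (w, 0) (fun p => 1 + fderiv ℝ P p (0, p.1)) p =
      dirDeriv (0, w) P p * (1 + fderiv ℝ P p (0, p.1)) +
        P p * dirDeriv (0, w) (fun p => 1 + fderiv ℝ P p (0, p.1)) p := by
  have hd1 : ∀ q ∈ S, HasFDerivAt P (fderiv ℝ P q) q := fun q hq =>
    ((hP.contDiffAt (hS.mem_nhds hq)).differentiableAt (by simp)).hasFDerivAt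
  have hd2 : HasFDerivAt (fderiv ℝ P) (fderiv ℝ (fderiv ℝ P) p) p :=
    (((hP.fderiv_of_isOpen hS (m := ∞) (by simp)).contDiffAt (hS.mem_nhds hp)).differentiableAt
      (by simp)).hasFDerivAt
  have hB : ∀ u : Plane × Plane, dirDeriv u (fun p => 1 + fderiv ℝ P p (0, p.1)) p =
      fderiv ℝ (fderiv ℝ P) p u (0, p.1) + fderiv ℝ P p (0, u.1) := by
    intro u
    have h1 : HasFDerivAt (fun p : Plane × Plane => ((0 : Plane), p.1)) _ p :=
      (hasFDerivAt_const (0 : Plane) p).prodMk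
        (hasFDerivAt_fst (𝕜 := ℝ) (E := Plane) (F := Plane) (p := p))
    have h2 : HasFDerivAt (fun p => 1 + fderiv ℝ P p (0, p.1)) _ p :=
      (hd2.clm_apply h1).const_add 1
    simp only [dirDeriv]
    rw [h2.fderiv]
    simp [add_comm]
  rw [hB, hB]
  -- the mixed derivative is found by differentiating `P_x = P P_y` in the direction `(0, x)`
  have hmix : fderiv ℝ (fderiv ℝ P) p (w, 0) (0, p.1) =
      P p * fderiv ℝ (fderiv ℝ P) p (0, p.1) (0, w) +
        fderiv ℝ P p (0, w) * fderiv ℝ P p (0, p.1) := by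
    rw [← dirDeriv_dirDeriv_eq hS hP (w, 0) (0, p.1) hp, dirDeriv_comm hS hP (w, 0) (0, p.1) hp,
      dirDeriv_congr hS hPDE (0, p.1) hp, ← dirDeriv_dirDeriv_eq hS hP (0, p.1) (0, w) hp]
    have h3 : HasFDerivAt (dirDeriv (0, w) P) (fderiv ℝ (dirDeriv (0, w) P) p) p :=
      (((contDiffOn_dirDeriv hS hP (0, w)).contDiffAt (hS.mem_nhds hp)).differentiableAt
        (by simp)).hasFDerivAt
    have h4 : fderiv ℝ (fun q => P q * dirDeriv (0, w) P q) p = _ := ((hd1 p hp).mul h3).fderiv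
    simp only [dirDeriv] at h4 ⊢
    rw [h4]
    simp
  have hsymm : fderiv ℝ (fderiv ℝ P) p (0, p.1) (0, w) =
      fderiv ℝ (fderiv ℝ P) p (0, w) (0, p.1) := by
    rw [← dirDeriv_dirDeriv_eq hS hP _ _ hp, ← dirDeriv_dirDeriv_eq hS hP _ _ hp,
      dirDeriv_comm hS hP _ _ hp]
  have hz : fderiv ℝ P p ((0 : Plane), (0 : Plane)) = 0 := map_zero (fderiv ℝ P p)
  rw [hmix, hsymm]
  simp only [dirDeriv, hz]
  ring

/-- For curvature `0` the potential is `Q = P F`. -/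
theorem projectivelyFlat_flatF {ψ φ : Plane → ℝ} (hψ : IsMinkowskiNorm ψ)
    (hφ : IsWeakMinkowskiNorm φ) : ProjectivelyFlat {x | φ x < 1} (flatF ψ φ)
      fun x y => funkSolution φ x y * flatF ψ φ x y := by
  have h := hφ.funkAdmissible
  have hΩ := hφ.isOpen_sublevel
  set Ω := {x | φ x < 1} with hΩdef
  have hS := FunkAdmissible.isOpen_prod hΩ
  have hP := h.contDiffOn_funkSolution hΩ
  have hslice : ∀ x ∈ Ω, ∀ y, y ≠ 0 → fderiv ℝ (funkSolution φ x) y x =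
      fderiv ℝ (fun p : Plane × Plane => funkSolution φ p.1 p.2) (x, y) (0, x) := by
    intro x hx y hy
    have h1 : HasFDerivAt (funkSolution φ x) _ y :=
      (h.hasFDerivAt_funkSolution hΩ (mk_mem_prod hx hy)).comp y (hasFDerivAt_prodMk_right x y)
    rw [h1.fderiv]
    simp
  set A : Plane × Plane → ℝ := fun p => ψ (p.2 + funkSolution φ p.1 p.2 • p.1) with hA
  set B : Plane × Plane → ℝ := fun p =>
    1 + fderiv ℝ (fun p : Plane × Plane => funkSolution φ p.1 p.2) p (0, p.1) with hB
  have hF : ∀ p ∈ Ω ×ˢ ({0}ᶜ : Set Plane), flatF ψ φ p.1 p.2 = A p * B p := by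
    intro p hp
    simp only [flatF, hA, hB]
    rw [hslice p.1 hp.1 p.2 hp.2]
  have hAs : ContDiffOn ℝ ∞ A (Ω ×ˢ {0}ᶜ) := h.contDiffOn_comp hΩ hψ.smooth
  have hBs : ContDiffOn ℝ ∞ B (Ω ×ˢ {0}ᶜ) :=
    contDiffOn_const.add ((hP.fderiv_of_isOpen hS (by simp)).clm_apply (by fun_prop))
  have hFs : ContDiffOn ℝ ∞ (fun p : Plane × Plane => flatF ψ φ p.1 p.2) (Ω ×ˢ {0}ᶜ) :=
    (hAs.mul hBs).congr hF
  have hhom : ∀ x ∈ Ω, PosHomogeneous (flatF ψ φ x) := by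
    intro x hx c hc y
    by_cases hy : y = 0
    · subst hy
      have h0 := (h.posHomogeneous_funkSolution hx).map_zero
      simp [flatF, h0, hψ.homogeneous.map_zero]
    · have h1 := dirDeriv_smul_snd hS hP
        (fun p hp => ⟨hp.1, smul_ne_zero hc.ne' hp.2⟩)
        (fun p hp => h.funkSolution_smul hp.1 hc p.2) x (mk_mem_prod hx hy)
      have h2 := mul_left_cancel₀ hc.ne' h1
      simp only [dirDeriv] at h2
      simp only [flatF]
      rw [hslice x hx _ (smul_ne_zero hc.ne' hy), hslice x hx y hy, h2, h.funkSolution_smul hx hc,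
        ← mul_assoc, ← hψ.homogeneous c hc, smul_add, smul_smul]
  refine ⟨hΩ, hφ.convex_sublevel, hhom, ?_, hFs, hP.mul hFs, ?_, ?_⟩
  · intro x hx y hy
    have hp : ((x, y) : Plane × Plane) ∈ Ω ×ˢ ({0}ᶜ : Set Plane) := ⟨hx, hy⟩
    exact hF _ hp ▸ mul_pos (hψ.pos _ (h.add_smul_ne_zero hx hy)) (h.one_add_dirDeriv_pos hΩ hp)
  · intro c hc x hx y _
    rw [h.funkSolution_smul hx hc, hhom x hx c hc]
    ring
  · intro w
    have hQ : EqOn (fun p : Plane × Plane => funkSolution φ p.1 p.2 * flatF ψ φ p.1 p.2)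
        (fun p => funkSolution φ p.1 p.2 * (A p * B p)) (Ω ×ˢ {0}ᶜ) := fun p hp => by
      simp only [hF p hp]
    intro p hp
    rw [dirDeriv_congr hS hF _ hp, dirDeriv_congr hS hQ _ hp]
    have e1 := h.dirDeriv_comp hΩ hψ.smooth w hp
    have e2 := dirDeriv_one_add hS hP (fun q hq => h.dirDeriv_funkSolution hΩ w hq) hp
    have dA : HasFDerivAt A (fderiv ℝ A p) p :=
      ((hAs.contDiffAt (hS.mem_nhds hp)).differentiableAt (by simp)).hasFDerivAt
    have dB : HasFDerivAt B (fderiv ℝ B p) p :=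
      ((hBs.contDiffAt (hS.mem_nhds hp)).differentiableAt (by simp)).hasFDerivAt
    have dP := h.hasFDerivAt_funkSolution hΩ hp
    have f1 : fderiv ℝ (fun p => A p * B p) p = _ := (dA.mul dB).fderiv
    have f2 : fderiv ℝ (fun p : Plane × Plane => funkSolution φ p.1 p.2 * (A p * B p)) p = _ :=
      (dP.mul (dA.mul dB)).fderiv
    change fderiv ℝ A p (w, 0) = funkSolution φ p.1 p.2 * fderiv ℝ A p (0, w) at e1
    change fderiv ℝ B p (w, 0) =
      fderiv ℝ (fun p : Plane × Plane => funkSolution φ p.1 p.2) p (0, w) * B p +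
        funkSolution φ p.1 p.2 * fderiv ℝ B p (0, w) at e2
    simp only [dirDeriv]
    rw [f1, f2]
    simp only [add_apply, smul_apply, smul_eq_mul, Pi.mul_apply]
    rw [e1, e2]
    ring

/-- For curvature `-1` the potential is `Q = (Φ₊² - Φ₋²) / 4`. -/
theorem projectivelyFlat_hyperbolicF {ψ φ : Plane → ℝ} (hψ : IsMinkowskiNorm ψ)
    (hφ : PosHomogeneous φ) (hsum : IsWeakMinkowskiNorm (ψ + φ))
    (hsign : (∀ y, y ≠ 0 → ψ y < φ y) ∨ (∀ y, y ≠ 0 → -ψ y < φ y ∧ φ y < ψ y))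
    (hu : ∀ x ∈ {x | φ x + ψ x < 1}, ∀ y, ∃! t : ℝ, t = (φ - ψ) (y + t • x)) :
    ProjectivelyFlat {x | φ x + ψ x < 1} (hyperbolicF ψ φ) fun x y =>
      (funkSolution (φ + ψ) x y ^ 2 - funkSolution (φ - ψ) x y ^ 2) / 4 := by
  have hsum' : IsWeakMinkowskiNorm (φ + ψ) := add_comm ψ φ ▸ hsum
  have hp := hsum'.funkAdmissible
  have hΩ : IsOpen {x | φ x + ψ x < 1} := hsum'.isOpen_sublevel
  have hconv : Convex ℝ {x | φ x + ψ x < 1} := hsum'.convex_sublevel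
  have hdiff : φ - ψ = fun y => (φ + ψ) y - 2 * ψ y := by
    ext y; simp only [Pi.sub_apply, Pi.add_apply]; ring
  have hm : FunkAdmissible (φ - ψ) {x | φ x + ψ x < 1} := by
    refine funkAdmissible_of_unique hΩ ?_ ?_ ?_ ?_ hu
    · rw [hdiff]
      exact hsum'.continuous.sub (continuous_const.mul hψ.continuous)
    · intro c hc y
      simp only [Pi.sub_apply, hφ c hc, hψ.homogeneous c hc]
      ring
    · rw [hdiff]
      exact hsum'.smooth.sub (contDiffOn_const.mul hψ.smooth)
    · have h0 : (φ - ψ) 0 = 0 := by simp [hφ.map_zero, hψ.homogeneous.map_zero]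
      rcases hsign with h | h
      · refine Or.inl fun y => ?_
        by_cases hy : y = 0
        · rw [hy, h0]
        · exact (sub_pos.2 (h y hy)).le
      · refine Or.inr fun y => ?_
        by_cases hy : y = 0
        · rw [hy, h0]
        · exact (sub_neg.2 (h y hy).2).le
  have hp : FunkAdmissible (φ + ψ) {x | φ x + ψ x < 1} := hp
  set Ω := {x | φ x + ψ x < 1} with hΩdef
  have hS := FunkAdmissible.isOpen_prod hΩ
  have sp := hp.contDiffOn_funkSolution hΩ
  have sm := hm.contDiffOn_funkSolution hΩ
  refine ⟨hΩ, hconv, ?_, ?_, ?_, ?_, ?_, ?_⟩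
  · intro x hx c hc y
    simp only [hyperbolicF, hp.funkSolution_smul hx hc, hm.funkSolution_smul hx hc]
    ring
  · intro x hx y hy
    have hx1 : (φ + ψ) x < 1 := hx
    have hlt : funkSolution (φ - ψ) x y < funkSolution (φ + ψ) x y := by
      set t := funkSolution (φ - ψ) x y with ht
      set s := funkSolution (φ + ψ) x y with hs
      have h1 : t = (φ - ψ) (y + t • x) := hm.spec hx y
      have h2 : s = (φ + ψ) (y + s • x) := hp.spec hx y
      have h3 := hψ.pos _ (hm.add_smul_ne_zero hx hy)
      have h4 : t < (φ + ψ) (y + t • x) := by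
        simp only [Pi.sub_apply, Pi.add_apply] at h1 ⊢
        linarith
      by_contra! hle
      have h5 := hsum'.subadditive (y + s • x) ((t - s) • x)
      rw [hsum'.map_smul (sub_nonneg.2 hle), ← h2] at h5
      have e : y + s • x + (t - s) • x = y + t • x := by module
      rw [e] at h5
      nlinarith
    simp only [hyperbolicF]
    linarith
  · exact (sp.sub sm).div_const 2
  · exact ((sp.pow 2).sub (sm.pow 2)).div_const 4
  · intro c hc x hx y _
    simp only [hp.funkSolution_smul hx hc, hm.funkSolution_smul hx hc]
    ring
  · intro w p hpS
    have dp := hp.hasFDerivAt_funkSolution hΩ hpS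
    have dm := hm.hasFDerivAt_funkSolution hΩ hpS
    have e1 := hp.dirDeriv_funkSolution hΩ w hpS
    have e2 := hm.dirDeriv_funkSolution hΩ w hpS
    have f1 : fderiv ℝ (fun p : Plane × Plane => hyperbolicF ψ φ p.1 p.2) p = _ :=
      ((dp.sub dm).mul_const (2⁻¹ : ℝ)).fderiv
    have f2 : fderiv ℝ (fun p : Plane × Plane =>
        (funkSolution (φ + ψ) p.1 p.2 ^ 2 - funkSolution (φ - ψ) p.1 p.2 ^ 2) / 4) p = _ :=
      (((dp.pow 2).sub (dm.pow 2)).mul_const (4⁻¹ : ℝ)).fderiv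
    simp only [dirDeriv] at e1 e2 ⊢
    rw [f1, f2]
    simp only [sub_apply, smul_apply, smul_eq_mul, e1, e2]
    ring

end Hilbert4

theorem theorem3p13 :
    -- curvature `0`
    (∀ ψ φ : Hilbert4.Plane → ℝ,
      Hilbert4.IsMinkowskiNorm ψ → Hilbert4.IsWeakMinkowskiNorm φ →
      ∀ (Ω O : Set Hilbert4.Plane) (F : Hilbert4.Plane → Hilbert4.Plane → ℝ),
        Ω = {x | φ x < 1} → F = Hilbert4.flatF ψ φ → O = Hilbert4.minkowskiLocus Ω F →
        (∀ U, Hilbert4.IsComponent O U → IsOpen U ∧ Convex ℝ U) ∧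
        (∀ᵐ x ∂(μH[1] : Measure Hilbert4.Plane), x ∈ frontier O ∩ Ω →
          ∀ y, y ≠ 0 → (Hilbert4.hessianSq (F x) y).det = 0 →
            Hilbert4.IsTangentToBoundary O x y) ∧
        ((frontier O ∩ Ω).Nonempty →
          ∃ x ∈ frontier O ∩ Ω, ∃ y, y ≠ 0 ∧ (Hilbert4.hessianSq (F x) y).det = 0 ∧
            Hilbert4.IsTangentToBoundary O x y ∧
            ∃ U, Hilbert4.IsComponent O U ∧ x ∈ frontier U)) ∧
    -- curvature `-1`
    (∀ ψ φ : Hilbert4.Plane → ℝ,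
      Hilbert4.IsMinkowskiNorm ψ → Hilbert4.PosHomogeneous φ →
      Hilbert4.IsWeakMinkowskiNorm (ψ + φ) →
      ((∀ y, y ≠ 0 → ψ y < φ y) ∨ (∀ y, y ≠ 0 → -ψ y < φ y ∧ φ y < ψ y)) →
      ∀ (Ω O : Set Hilbert4.Plane) (F : Hilbert4.Plane → Hilbert4.Plane → ℝ),
        Ω = {x | φ x + ψ x < 1} →
        (∀ x ∈ Ω, ∀ y, ∃! t : ℝ, t = (φ - ψ) (y + t • x)) →
        F = Hilbert4.hyperbolicF ψ φ → O = Hilbert4.minkowskiLocus Ω F →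
        (∀ U, Hilbert4.IsComponent O U → IsOpen U ∧ Convex ℝ U) ∧
        (∀ᵐ x ∂(μH[1] : Measure Hilbert4.Plane), x ∈ frontier O ∩ Ω →
          ∀ y, y ≠ 0 → (Hilbert4.hessianSq (F x) y).det = 0 →
            Hilbert4.IsTangentToBoundary O x y) ∧
        ((frontier O ∩ Ω).Nonempty →
          ∃ x ∈ frontier O ∩ Ω, ∃ y, y ≠ 0 ∧ (Hilbert4.hessianSq (F x) y).det = 0 ∧
            Hilbert4.IsTangentToBoundary O x y ∧
            ∃ U, Hilbert4.IsComponent O U ∧ x ∈ frontier U)) := by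
  refine ⟨?_, ?_⟩
  · rintro ψ φ hψ hφ Ω O F rfl rfl hO
    exact (Hilbert4.projectivelyFlat_flatF hψ hφ).minkowskiLocus_structure hO
  · rintro ψ φ hψ hφ hsum hsign Ω O F rfl hu rfl hO
    exact (Hilbert4.projectivelyFlat_hyperbolicF hψ hφ hsum hsign hu).minkowskiLocus_structure hO
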